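/- **Setting.** Let $\Omega\subset\mathbb R^n$ be a bounded connected open set with Lipschitz boundary. For each $x\in\overline\Omega$ let $K(x)\subset\mathbb R^n$ be a compact convex set such that, for some $\alpha,M>0$, $B(0,\alpha)\subset K(x)\subset B(0,M)$ for all $x\in\overline\Omega$, and such that for every $p\in\mathbb R^n$ the Minkowski functional $x\mapsto\inf\{t>0: p/t\in K(x)\}$ is continuous on $\overline\Omega$. Put $\varphi^0(x,q)=\sup\{p\cdot q: p\in K(x)\}$. For $A\subset\mathbb R^n$, an *arc-length curve in $A$ from $a$ to $b$* is a Lipschitz map $\gamma:[0,\ell(\gamma)]\to A$, $\ell(\gamma)\ge 0$, with $\gamma(0)=a$, $\gamma(\ell(\gamma))=b$ and $|\dot\gamma|=1$ a.e.; write $L(\gamma)=\int_0^{\ell(\gamma)}\varphi^0(\gamma(s),\dot\gamma(s))\,ds$. For $a,b\in\Omega$ let $d(a,b)$ be the infimum of $L(\gamma)$ over arc-length curves in $\Omega$ from $a$ to $b$, and extend $d$ to $a,b\in\overline\Omega$ by $$d(a,b)=\inf\Big\{\liminf_{k\to\infty}d(a_k,b_k): a_k,b_k\in\Omega,\ a_k\to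 a,\ b_k\to b\Big\}.$$ (The extended $d$ agrees with the original one on $\Omega\times\Omega$.) Let $g:\partial\Omega\to\mathbb R$ be continuous with $g(y_2)-g(y_1)\le d(y_1,y_2)$ for all $y_1,y_2\in\partial\Omega$, and for $x\in\overline\Omega$ let $$S^-(x)=\sup_{y\in\partial\Omega}\{g(y)-d(x,y)\},\qquad S^+(x)=\inf_{y\in\partial\Omega}\{g(y)+d(y,x)\}.$$ A solution of (P) is a function $u\in W^{1,\infty}(\Omega)\cap C(\overline\Omega)$ with $u=g$ on $\partial\Omega$ and $\nabla u(x)\in K(x)$ for a.e. $x\in\Omega$. **Theorem.** Let $x\in\Omega$ satisfy $S^-(x)=S^+(x)$. Let $y_1,y_2\in\partial\Omega$, let $\gamma_1$ be an arc-length curve in $\overline\Omega$ from $y_1$ to $x$, and let $\gamma_2$ be an arc-length curve in $\overline\Omega$ from $x$ to $y_2$, such that $$S^+(x)=g(y_1)+L(\gamma_1),\qquad S^-(x)=g(y_2)-L(\gamma_2).$$ Define $\gamma:[0,\ell(\gamma_1)+\ell(\gamma_2)]\to\overline\Omega$ by $\gamma(t)=\gamma_1(t)$ for $0\le t\le\ell(\gamma_1)$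 and $\gamma(t)=\gamma_2(t-\ell(\gamma_1))$ for $\ell(\gamma_1)<t\le\ell(\gamma_1)+\ell(\gamma_2)$. Then: 1. $\gamma$ is an arc-length curve in $\overline\Omega$ from $y_1$ to $y_2$, and it is a geodesic for $d$: $d(y_1,y_2)=L(\gamma)<\infty$. 2. For every point $z$ of $\gamma$, the values $S^-(z)$ and $S^+(z)$ are finite and equal, and $S^-(z)=u(z)=S^+(z)$ for every solution $u$ of (P). 3. For $\mathcal H^1$-a.e. point $z$ of $\gamma$ the following holds whenever $z=\gamma(s)$ with $0<s<\ell(\gamma_1)+\ell(\gamma_2)$: $\gamma$ is differentiable at $s$, and $S^+\circ\gamma$, $S^-\circ\gamma$ and $u\circ\gamma$, for every solution $u$ of (P), are differentiable at $s$ with derivative $\varphi^0(\gamma(s),\dot\gamma(s))$. -/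

import Mathlib

open Set Filter Topology MeasureTheory

noncomputable section

/-- The boundary of `Ω` is Lipschitz: near each boundary point, in suitable orthonormal coordinates,
`Ω` is the strict epigraph of a Lipschitz function. Here `e` is the unit vector of the vertical axis,
`x - ⟪e, x⟫ e` is the horizontal part of `x`, and only the restriction of `f` to the hyperplane
orthogonal to `e` is used. -/
def HasLipschitzBoundary {n : ℕ} (Ω : Set (EuclideanSpace ℝ (Fin n))) : Prop :=
  ∀ z ∈ frontier Ω, ∃ (e : EuclideanSpace ℝ (Fin n)) (f : EuclideanSpace ℝ (Fin n) → ℝ)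
    (C : NNReal) (U : Set (EuclideanSpace ℝ (Fin n))),
    ‖e‖ = 1 ∧ LipschitzWith C f ∧ IsOpen U ∧ z ∈ U ∧
      ∀ x ∈ U, x ∈ Ω ↔ f (x - (inner ℝ e x : ℝ) • e) < (inner ℝ e x : ℝ)

/-- The support function `φ⁰(x, q) = sup {p · q | p ∈ K x}`. -/
def supportFun {n : ℕ} (K : EuclideanSpace ℝ (Fin n) → Set (EuclideanSpace ℝ (Fin n)))
    (x q : EuclideanSpace ℝ (Fin n)) : ℝ :=
  sSup ((fun p : EuclideanSpace ℝ (Fin n) => (inner ℝ p q : ℝ)) '' K x)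

/-- `γ : [0, l] → A` is a Lipschitz (that is, `W^{1,∞}` and continuous) curve from `x` to `y`,
parametrized by arc length; `l` is then its Euclidean length. The values of `γ` outside `[0, l]`
play no role. With `A = Ω` this is the class `path(x, y)`, and with `A = closure Ω` it is the class
`pathbar(x, y)`. -/
structure IsUnitSpeedPath {n : ℕ} (A : Set (EuclideanSpace ℝ (Fin n))) (l : ℝ)
    (γ : ℝ → EuclideanSpace ℝ (Fin n)) (x y : EuclideanSpace ℝ (Fin n)) : Prop where
  length_nonneg : 0 ≤ l
  lipschitz : ∃ C : NNReal, LipschitzOnWith C γ (Icc 0 l)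
  mapsTo : MapsTo γ (Icc 0 l) A
  source : γ 0 = x
  target : γ l = y
  unitSpeed : ∀ᵐ s ∂(volume.restrict (Ioo 0 l)), DifferentiableAt ℝ γ s ∧ ‖deriv γ s‖ = 1

/-- The Finslerian length `∫₀ˡ φ⁰(γ(s), γ'(s)) ds`. -/
def finslerLength {n : ℕ} (K : EuclideanSpace ℝ (Fin n) → Set (EuclideanSpace ℝ (Fin n)))
    (l : ℝ) (γ : ℝ → EuclideanSpace ℝ (Fin n)) : ENNReal :=
  ∫⁻ s in Ioo 0 l, ENNReal.ofReal (supportFun K (γ s) (deriv γ s))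

/-- The distance between points of `Ω`: the infimum of the Finslerian lengths of curves in `Ω`. -/
def interiorDist {n : ℕ} (Ω : Set (EuclideanSpace ℝ (Fin n)))
    (K : EuclideanSpace ℝ (Fin n) → Set (EuclideanSpace ℝ (Fin n)))
    (x y : EuclideanSpace ℝ (Fin n)) : ENNReal :=
  ⨅ (l : ℝ) (γ : ℝ → EuclideanSpace ℝ (Fin n)) (_ : IsUnitSpeedPath Ω l γ x y),
    finslerLength K l γ

/-- The extension of the distance to points of `closure Ω`: the infimum of `liminf d(xₙ, yₙ)` over
all sequences in `Ω` with `xₙ → x` and `yₙ → y`. -/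
def finslerDist {n : ℕ} (Ω : Set (EuclideanSpace ℝ (Fin n)))
    (K : EuclideanSpace ℝ (Fin n) → Set (EuclideanSpace ℝ (Fin n)))
    (x y : EuclideanSpace ℝ (Fin n)) : ENNReal :=
  ⨅ (xs : ℕ → EuclideanSpace ℝ (Fin n)) (ys : ℕ → EuclideanSpace ℝ (Fin n))
    (_ : (∀ k, xs k ∈ Ω) ∧ (∀ k, ys k ∈ Ω) ∧
      Tendsto xs atTop (𝓝 x) ∧ Tendsto ys atTop (𝓝 y)),
    liminf (fun k => interiorDist Ω K (xs k) (ys k)) atTop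

/-- `S⁻(x) = sup {g(y) - d(x, y) | y ∈ ∂Ω}`. -/
def sMinus {n : ℕ} (Ω : Set (EuclideanSpace ℝ (Fin n)))
    (K : EuclideanSpace ℝ (Fin n) → Set (EuclideanSpace ℝ (Fin n)))
    (g : EuclideanSpace ℝ (Fin n) → ℝ) (x : EuclideanSpace ℝ (Fin n)) : EReal :=
  ⨆ y ∈ frontier Ω, ((g y : EReal) - (finslerDist Ω K x y : EReal))

/-- `S⁺(x) = inf {g(y) + d(y, x) | y ∈ ∂Ω}`. -/
def sPlus {n : ℕ} (Ω : Set (EuclideanSpace ℝ (Fin n)))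
    (K : EuclideanSpace ℝ (Fin n) → Set (EuclideanSpace ℝ (Fin n)))
    (g : EuclideanSpace ℝ (Fin n) → ℝ) (x : EuclideanSpace ℝ (Fin n)) : EReal :=
  ⨅ y ∈ frontier Ω, ((g y : EReal) + (finslerDist Ω K y x : EReal))

/-- `v` is the weak (distributional) gradient of `u` on `Ω`. -/
def IsWeakGradient {n : ℕ} (Ω : Set (EuclideanSpace ℝ (Fin n)))
    (u : EuclideanSpace ℝ (Fin n) → ℝ)
    (v : EuclideanSpace ℝ (Fin n) → EuclideanSpace ℝ (Fin n)) : Prop :=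
  ∀ η : EuclideanSpace ℝ (Fin n) → ℝ, ContDiff ℝ (⊤ : ℕ∞) η → HasCompactSupport η →
    tsupport η ⊆ Ω → ∀ e : EuclideanSpace ℝ (Fin n),
      ∫ x in Ω, u x * fderiv ℝ η x e = - ∫ x in Ω, (inner ℝ (v x) e : ℝ) * η x

/-- `u ∈ W^{1,∞}(Ω) ∩ C(closure Ω)` solves `u = g` on `∂Ω`, `∇u(x) ∈ K(x)` for a.e. `x ∈ Ω`. -/
structure IsSolution {n : ℕ} (Ω : Set (EuclideanSpace ℝ (Fin n)))
    (K : EuclideanSpace ℝ (Fin n) → Set (EuclideanSpace ℝ (Fin n)))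
    (g u : EuclideanSpace ℝ (Fin n) → ℝ) : Prop where
  continuousOn : ContinuousOn u (closure Ω)
  memLp : MemLp u ⊤ (volume.restrict Ω)
  boundary : ∀ y ∈ frontier Ω, u y = g y
  gradient : ∃ v : EuclideanSpace ℝ (Fin n) → EuclideanSpace ℝ (Fin n),
    MemLp v ⊤ (volume.restrict Ω) ∧ IsWeakGradient Ω u v ∧
      ∀ᵐ x ∂(volume.restrict Ω), v x ∈ K x

/-- The curve that runs along `γ₁` on `[0, l₁]` and then along `γ₂`. -/
def concatCurve {n : ℕ} (l₁ : ℝ) (γ₁ γ₂ : ℝ → EuclideanSpace ℝ (Fin n)) (t : ℝ) :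
    EuclideanSpace ℝ (Fin n) :=
  if t ≤ l₁ then γ₁ t else γ₂ (t - l₁)

end

/-!
The curve `γ` obtained by running along `γ₁` and then along `γ₂` is a calibrated curve: from
`S⁻(x) = S⁺(x)` and the optimality of both pieces, the boundary datum grows from `y₁` to `y₂` by
exactly the Finslerian length `L(γ)` (`isCalibrated_concatCurve`). Everything else follows from
three facts about the extended distance `d`.

* `IsFinslerField.finslerDist_triangle`: `d` satisfies the triangle inequality on the closure. The
  intermediate point may lie on the boundary, and is there approached by two unrelated sequences;
  they are joined by short paths in `Ω` because a Lipschitz domain contains, near each boundary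
  point, a cone of directions (`HasLipschitzBoundary.exists_cone`).
* `IsFinslerField.finslerDist_le_finslerArc`: the length of any path in the closure dominates `d`.
  Short arcs near the boundary are translated into `Ω` along the axis of the cone. This leaves the
  velocity unchanged, so the lengths converge by continuity of the support function. Long arcs are
  subdivided.
* `IsSolution.ofReal_sub_le_finslerDist`: a solution `u` satisfies `u(b) - u(a) ≤ d(a, b)`. For a
  mollification of `u` the gradient is an average of elements of nearby sets `K y`, and one
  integrates along paths in `Ω`.

Put `F(t) = g(y₁) + L(γ|[0, t])`. The second fact applied to the arcs of `γ` from `y₁` and to `y₂`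
gives `S⁺(γ(t)) ≤ F(t) ≤ S⁻(γ(t))`, and the third gives `u(γ(t)) = F(t)`. The compatibility of `g`
with `d` and the triangle inequality give `S⁻ ≤ S⁺`. So all these functions equal `F` along `γ`, and
the last assertion is the Lebesgue differentiation theorem for `F`, since a Lipschitz curve maps null
sets of parameters to `H¹`-null sets.
-/

/-! ### The support function -/

/-- The standing assumptions on the field of convex sets `K` over `closure Ω`, with the inner radius
`α` and the outer radius `M` made explicit. -/
structure IsFinslerField {n : ℕ} (Ω : Set (EuclideanSpace ℝ (Fin n)))
    (K : EuclideanSpace ℝ (Fin n) → Set (EuclideanSpace ℝ (Fin n))) (α M : ℝ) : Prop where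
  inner_pos : 0 < α
  outer_pos : 0 < M
  isCompact : ∀ x ∈ closure Ω, IsCompact (K x)
  convex : ∀ x ∈ closure Ω, Convex ℝ (K x)
  ball_subset : ∀ x ∈ closure Ω, Metric.ball 0 α ⊆ K x
  subset_ball : ∀ x ∈ closure Ω, K x ⊆ Metric.ball 0 M
  continuousOn_gauge : ∀ p : EuclideanSpace ℝ (Fin n),
    ContinuousOn (fun x => gauge (K x) p) (closure Ω)

namespace IsFinslerField

variable {n : ℕ} {Ω : Set (EuclideanSpace ℝ (Fin n))}
  {K : EuclideanSpace ℝ (Fin n) → Set (EuclideanSpace ℝ (Fin n))} {α M : ℝ}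
  {x p q : EuclideanSpace ℝ (Fin n)}

theorem zero_mem (h : IsFinslerField Ω K α M) (hx : x ∈ closure Ω) : 0 ∈ K x :=
  h.ball_subset x hx (Metric.mem_ball_self h.inner_pos)

theorem mem_nhds_zero (h : IsFinslerField Ω K α M) (hx : x ∈ closure Ω) : K x ∈ 𝓝 0 :=
  mem_of_superset (Metric.ball_mem_nhds 0 h.inner_pos) (h.ball_subset x hx)

theorem norm_le (h : IsFinslerField Ω K α M) (hx : x ∈ closure Ω) (hp : p ∈ K x) : ‖p‖ ≤ M := by
  exact (mem_ball_zero_iff.1 (h.subset_ball x hx hp)).le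

theorem mem_iff_gauge_le_one (h : IsFinslerField Ω K α M) (hx : x ∈ closure Ω) :
    p ∈ K x ↔ gauge (K x) p ≤ 1 := by
  rw [gauge_le_one_iff_mem_closure (h.convex x hx) (h.mem_nhds_zero hx),
    (h.isCompact x hx).isClosed.closure_eq]

theorem continuousOn_gauge_prod (h : IsFinslerField Ω K α M) :
    ContinuousOn (fun z : EuclideanSpace ℝ (Fin n) × EuclideanSpace ℝ (Fin n) => gauge (K z.1) z.2)
      (closure Ω ×ˢ univ) := by
  refine continuousOn_prod_of_continuousOn_lipschitzOnWith' _ (Real.toNNReal α)⁻¹ ?_ ?_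
  · intro a ha
    refine ((h.convex a ha).lipschitzWith_gauge (by simpa using h.inner_pos) ?_).lipschitzOnWith
    rw [Real.coe_toNNReal _ h.inner_pos.le]
    exact h.ball_subset a ha
  · exact fun b _ => h.continuousOn_gauge b

theorem inner_le_mul (h : IsFinslerField Ω K α M) (hx : x ∈ closure Ω) (hp : p ∈ K x) :
    inner ℝ p q ≤ M * ‖q‖ :=
  (real_inner_le_norm p q).trans (mul_le_mul_of_nonneg_right (h.norm_le hx hp) (norm_nonneg q))

theorem inner_le_supportFun (h : IsFinslerField Ω K α M) (hx : x ∈ closure Ω) (hp : p ∈ K x) :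
    inner ℝ p q ≤ supportFun K x q := by
  refine le_csSup ⟨M * ‖q‖, ?_⟩ (mem_image_of_mem _ hp)
  rintro _ ⟨p', hp', rfl⟩
  exact h.inner_le_mul hx hp'

theorem exists_inner_eq_supportFun (h : IsFinslerField Ω K α M) (hx : x ∈ closure Ω)
    (q : EuclideanSpace ℝ (Fin n)) : ∃ p ∈ K x, inner ℝ p q = supportFun K x q := by
  have := ((h.isCompact x hx).image (f := fun p => (inner ℝ p q : ℝ)) (by fun_prop)).sSup_mem
    ((nonempty_of_mem (h.zero_mem hx)).image _)
  exact this

theorem supportFun_nonneg (h : IsFinslerField Ω K α M) (hx : x ∈ closure Ω) :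
    0 ≤ supportFun K x q := by
  simpa using h.inner_le_supportFun (q := q) hx (h.zero_mem hx)

theorem supportFun_le (h : IsFinslerField Ω K α M) (hx : x ∈ closure Ω) :
    supportFun K x q ≤ M * ‖q‖ := by
  obtain ⟨p, hp, he⟩ := h.exists_inner_eq_supportFun hx q
  exact he ▸ h.inner_le_mul hx hp

theorem supportFun_le_of_norm_eq_one (h : IsFinslerField Ω K α M) (hx : x ∈ closure Ω)
    (hq : ‖q‖ = 1) : supportFun K x q ≤ M := by
  simpa [hq] using h.supportFun_le (q := q) hx

theorem lipschitzWith_supportFun (h : IsFinslerField Ω K α M) (hx : x ∈ closure Ω) :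
    LipschitzWith (Real.toNNReal M) (supportFun K x) := by
  refine LipschitzWith.of_le_add_mul _ fun q q' => ?_
  obtain ⟨p, hp, he⟩ := h.exists_inner_eq_supportFun hx q
  have h1 : (inner ℝ p q : ℝ) = inner ℝ p q' + inner ℝ p (q - q') := by
    rw [inner_sub_right]; ring
  rw [← he, h1, Real.coe_toNNReal _ h.outer_pos.le, dist_eq_norm]
  exact add_le_add (h.inner_le_supportFun hx hp) (h.inner_le_mul hx hp)

/-- For a fixed covector the support function inherits continuity from the gauges. Lower
semicontinuity comes from rescaling a maximiser into the neighbouring set. For upper semicontinuity,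
the compact set of those `p` with `‖p‖ ≤ M` and `p · q ≥ a` has gauge `> 1` at `x`, hence at all
nearby points. -/
theorem continuousOn_supportFun_left (h : IsFinslerField Ω K α M)
    (q : EuclideanSpace ℝ (Fin n)) : ContinuousOn (fun x => supportFun K x q) (closure Ω) := by
  intro x hx
  refine tendsto_order.2 ⟨fun a ha => ?_, fun a ha => ?_⟩
  · obtain ⟨p, hp, he⟩ := h.exists_inner_eq_supportFun hx q
    have h1 : gauge (K x) p ≤ 1 := (h.mem_iff_gauge_le_one hx).1 hp
    have hc : ContinuousWithinAt (fun y => (max 1 (gauge (K y) p))⁻¹ * (inner ℝ p q : ℝ))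
        (closure Ω) x := by
      refine ContinuousWithinAt.mul (ContinuousWithinAt.inv₀ ?_ (by positivity))
        continuousWithinAt_const
      exact continuousWithinAt_const.max (h.continuousOn_gauge p x hx)
    have hx' : a < (max 1 (gauge (K x) p))⁻¹ * (inner ℝ p q : ℝ) := by
      simpa [max_eq_left h1, he] using ha
    filter_upwards [hc.eventually (lt_mem_nhds hx'), self_mem_nhdsWithin] with y hy hyΩ
    refine hy.trans_le ?_
    have hpos : 0 < max 1 (gauge (K y) p) := by positivity
    have hm : (max 1 (gauge (K y) p))⁻¹ • p ∈ K y := by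
      rw [h.mem_iff_gauge_le_one hyΩ, gauge_smul_of_nonneg (by positivity), smul_eq_mul,
        inv_mul_le_iff₀ hpos, mul_one]
      exact le_max_right _ _
    simpa [real_inner_smul_left] using h.inner_le_supportFun (q := q) hyΩ hm
  · have hC : IsCompact (Metric.closedBall (0 : EuclideanSpace ℝ (Fin n)) M ∩
        {p | a ≤ (inner ℝ p q : ℝ)}) :=
      (isCompact_closedBall _ _).inter_right (isClosed_le (by fun_prop) (by fun_prop))
    have hev : ∀ᶠ y in 𝓝 x, ∀ p ∈ Metric.closedBall (0 : EuclideanSpace ℝ (Fin n)) M ∩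
        {p | a ≤ (inner ℝ p q : ℝ)}, y ∈ closure Ω → 1 < gauge (K y) p := by
      refine hC.eventually_forall_of_forall_eventually fun p hp => ?_
      have h1 : 1 < gauge (K x) p := by
        by_contra! hle
        exact (ha.trans_le hp.2).not_ge
          (h.inner_le_supportFun hx ((h.mem_iff_gauge_le_one hx).2 hle))
      have := (h.continuousOn_gauge_prod (x, p) ⟨hx, mem_univ _⟩).eventually (lt_mem_nhds h1)
      rw [eventually_nhdsWithin_iff] at this
      filter_upwards [this] with z hz hz' using hz ⟨hz', mem_univ _⟩
    filter_upwards [nhdsWithin_le_nhds hev, self_mem_nhdsWithin] with y hy hyΩ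
    obtain ⟨p, hp, he⟩ := h.exists_inner_eq_supportFun hyΩ q
    by_contra! hle
    exact (hy p ⟨by simpa using h.norm_le hyΩ hp, hle.trans_eq he.symm⟩ hyΩ).not_ge
      ((h.mem_iff_gauge_le_one hyΩ).1 hp)

theorem continuousOn_supportFun (h : IsFinslerField Ω K α M) :
    ContinuousOn (fun z : EuclideanSpace ℝ (Fin n) × EuclideanSpace ℝ (Fin n) =>
      supportFun K z.1 z.2) (closure Ω ×ˢ univ) :=
  continuousOn_prod_of_continuousOn_lipschitzOnWith' _ (Real.toNNReal M)
    (fun _ ha => (h.lipschitzWith_supportFun ha).lipschitzOnWith)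
    (fun q _ => h.continuousOn_supportFun_left q)

end IsFinslerField

/-! ### Unit speed paths and their lengths -/

section Paths

variable {n : ℕ} {A B Ω : Set (EuclideanSpace ℝ (Fin n))}
  {K : EuclideanSpace ℝ (Fin n) → Set (EuclideanSpace ℝ (Fin n))} {α M : ℝ}
  {l l₁ l₂ s t : ℝ} {γ γ₁ γ₂ : ℝ → EuclideanSpace ℝ (Fin n)} {x y z : EuclideanSpace ℝ (Fin n)}

/-- The Finslerian length of the arc of `γ` between the parameters `s` and `t`. -/
noncomputable def finslerArc (K : EuclideanSpace ℝ (Fin n) → Set (EuclideanSpace ℝ (Fin n)))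
    (γ : ℝ → EuclideanSpace ℝ (Fin n)) (s t : ℝ) : ENNReal :=
  ∫⁻ τ in Ioo s t, ENNReal.ofReal (supportFun K (γ τ) (deriv γ τ))

theorem finslerLength_eq_finslerArc : finslerLength K l γ = finslerArc K γ 0 l := rfl

theorem finslerArc_add_finslerArc {r : ℝ} (hrs : r ≤ s) (hst : s ≤ t) :
    finslerArc K γ r s + finslerArc K γ s t = finslerArc K γ r t := by
  unfold finslerArc
  simp only [restrict_Ioo_eq_restrict_Ioc]
  rw [← Ioc_union_Ioc_eq_Ioc hrs hst, lintegral_union measurableSet_Ioc]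
  exact Ioc_disjoint_Ioc_of_le le_rfl

theorem finslerArc_congr (h : EqOn γ₁ γ₂ (Ioo s t)) : finslerArc K γ₁ s t = finslerArc K γ₂ s t := by
  refine setLIntegral_congr_fun measurableSet_Ioo fun τ hτ => ?_
  have he : γ₁ =ᶠ[𝓝 τ] γ₂ := by
    filter_upwards [isOpen_Ioo.mem_nhds hτ] with r hr using h hr
  simp only [h hτ, he.deriv_eq]

theorem setLIntegral_Ioo_comp_add_left (f : ℝ → ENNReal) (a s t : ℝ) :
    ∫⁻ τ in Ioo s t, f (a + τ) = ∫⁻ τ in Ioo (a + s) (a + t), f τ := by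
  have h := (measurePreserving_add_left (volume : Measure ℝ) a).setLIntegral_comp_preimage_emb
    (measurableEmbedding_addLeft a) f (Ioo (a + s) (a + t))
  rw [← h]
  simp

theorem finslerArc_comp_add_left (a s t : ℝ) :
    finslerArc K (fun τ => γ (a + τ)) s t = finslerArc K γ (a + s) (a + t) := by
  unfold finslerArc
  rw [← setLIntegral_Ioo_comp_add_left (fun τ => ENNReal.ofReal (supportFun K (γ τ) (deriv γ τ)))]
  simp only [deriv_comp_const_add]

theorem ae_Ioo_comp_add_left {P : ℝ → Prop} {a s t : ℝ}
    (h : ∀ᵐ τ ∂(volume.restrict (Ioo (a + s) (a + t))), P τ) :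
    ∀ᵐ τ ∂(volume.restrict (Ioo s t)), P (a + τ) := by
  rw [ae_restrict_iff' measurableSet_Ioo] at h ⊢
  filter_upwards [(measurePreserving_add_left (volume : Measure ℝ) a).quasiMeasurePreserving.ae h]
    with τ hτ hm
  exact hτ ⟨by linarith [hm.1], by linarith [hm.2]⟩

namespace IsUnitSpeedPath

theorem mono_set (h : IsUnitSpeedPath A l γ x y) (hAB : A ⊆ B) : IsUnitSpeedPath B l γ x y :=
  ⟨h.length_nonneg, h.lipschitz, h.mapsTo.mono_right hAB, h.source, h.target, h.unitSpeed⟩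

theorem continuousOn (h : IsUnitSpeedPath A l γ x y) : ContinuousOn γ (Icc 0 l) :=
  h.lipschitz.choose_spec.continuousOn

/-- An arc of a unit speed path, translated by `v`, is a unit speed path. -/
theorem translate_arc (h : IsUnitSpeedPath A l γ x y) (hs : 0 ≤ s) (hst : s ≤ t) (htl : t ≤ l)
    (v : EuclideanSpace ℝ (Fin n)) (hB : ∀ τ ∈ Icc s t, γ τ + v ∈ B) :
    IsUnitSpeedPath B (t - s) (fun τ => γ (s + τ) + v) (γ s + v) (γ t + v) := by
  refine ⟨by linarith, ?_, ?_, by simp, by simp, ?_⟩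
  · obtain ⟨C, hC⟩ := h.lipschitz
    refine ⟨C, LipschitzOnWith.of_dist_le_mul fun a ha b hb => ?_⟩
    simpa using hC.dist_le_mul (s + a) ⟨by linarith [ha.1], by linarith [ha.2]⟩
      (s + b) ⟨by linarith [hb.1], by linarith [hb.2]⟩
  · exact fun τ hτ => hB _ ⟨by linarith [hτ.1], by linarith [hτ.2]⟩
  · have h1 : ∀ᵐ τ ∂(volume.restrict (Ioo (s + 0) (s + (t - s)))),
        DifferentiableAt ℝ γ τ ∧ ‖deriv γ τ‖ = 1 :=
      ae_mono (Measure.restrict_mono (Ioo_subset_Ioo (by linarith) (by linarith)) le_rfl)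
        h.unitSpeed
    filter_upwards [ae_Ioo_comp_add_left h1] with τ hτ
    refine ⟨?_, ?_⟩
    · exact (hτ.1.comp τ (by fun_prop : DifferentiableAt ℝ (fun r => s + r) τ)).add_const v
    · rw [deriv_add_const, deriv_comp_const_add]
      exact hτ.2

theorem arc (h : IsUnitSpeedPath A l γ x y) (hs : 0 ≤ s) (hst : s ≤ t) (htl : t ≤ l)
    (hB : ∀ τ ∈ Icc s t, γ τ ∈ B) :
    IsUnitSpeedPath B (t - s) (fun τ => γ (s + τ)) (γ s) (γ t) := by
  simpa using h.translate_arc hs hst htl 0 (by simpa using hB)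

theorem lipschitzOnWith_concatCurve {C : NNReal} (hl₁ : 0 ≤ l₁) (hl₂ : 0 ≤ l₂)
    (h₁ : LipschitzOnWith C γ₁ (Icc 0 l₁)) (h₂ : LipschitzOnWith C γ₂ (Icc 0 l₂))
    (hj : γ₁ l₁ = γ₂ 0) : LipschitzOnWith C (concatCurve l₁ γ₁ γ₂) (Icc 0 (l₁ + l₂)) := by
  have key : ∀ a ∈ Icc 0 (l₁ + l₂), ∀ b ∈ Icc 0 (l₁ + l₂), a ≤ b →
      dist (concatCurve l₁ γ₁ γ₂ a) (concatCurve l₁ γ₁ γ₂ b) ≤ C * dist a b := by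
    intro a ha b hb hab
    rw [dist_comm a b, Real.dist_eq, abs_of_nonneg (sub_nonneg.2 hab)]
    unfold concatCurve
    have e1 : ∀ c ∈ Icc 0 l₁, ∀ d ∈ Icc 0 l₁, c ≤ d → dist (γ₁ c) (γ₁ d) ≤ C * (d - c) := by
      intro c hc d hd hcd
      simpa [dist_comm c d, Real.dist_eq, abs_of_nonneg (sub_nonneg.2 hcd)]
        using h₁.dist_le_mul c hc d hd
    have e2 : ∀ c ∈ Icc 0 l₂, ∀ d ∈ Icc 0 l₂, c ≤ d → dist (γ₂ c) (γ₂ d) ≤ C * (d - c) := by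
      intro c hc d hd hcd
      simpa [dist_comm c d, Real.dist_eq, abs_of_nonneg (sub_nonneg.2 hcd)]
        using h₂.dist_le_mul c hc d hd
    split_ifs with h1 h2 h2
    · exact e1 a ⟨ha.1, h1⟩ b ⟨hb.1, h2⟩ hab
    · have u1 := e1 a ⟨ha.1, h1⟩ l₁ ⟨hl₁, le_rfl⟩ h1
      have u2 := e2 0 ⟨le_rfl, hl₂⟩ (b - l₁) ⟨by linarith, by linarith [hb.2]⟩ (by linarith)
      rw [hj] at u1
      refine (dist_triangle _ _ _).trans ((add_le_add u1 u2).trans (le_of_eq ?_))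
      ring
    · exact absurd (hab.trans h2) h1
    · have := e2 (a - l₁) ⟨by linarith, by linarith [ha.2]⟩ (b - l₁)
        ⟨by linarith, by linarith [hb.2]⟩ (by linarith)
      simpa using this
  refine LipschitzOnWith.of_dist_le_mul fun a ha b hb => ?_
  rcases le_total a b with hab | hab
  · exact key a ha b hb hab
  · rw [dist_comm, dist_comm a b]
    exact key b hb a ha hab

theorem concat (h₁ : IsUnitSpeedPath A l₁ γ₁ x y) (h₂ : IsUnitSpeedPath A l₂ γ₂ y z) :
    IsUnitSpeedPath A (l₁ + l₂) (concatCurve l₁ γ₁ γ₂) x z := by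
  have hl₁ := h₁.length_nonneg
  have hl₂ := h₂.length_nonneg
  refine ⟨by linarith, ?_, ?_, ?_, ?_, ?_⟩
  · obtain ⟨C₁, hC₁⟩ := h₁.lipschitz
    obtain ⟨C₂, hC₂⟩ := h₂.lipschitz
    exact ⟨max C₁ C₂, lipschitzOnWith_concatCurve hl₁ hl₂ (hC₁.weaken (le_max_left _ _))
      (hC₂.weaken (le_max_right _ _)) (h₁.target.trans h₂.source.symm)⟩
  · intro t ht
    unfold concatCurve
    split_ifs with h
    · exact h₁.mapsTo ⟨ht.1, h⟩
    · exact h₂.mapsTo ⟨by linarith, by linarith [ht.2]⟩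
  · simp [concatCurve, hl₁, h₁.source]
  · unfold concatCurve
    split_ifs with h
    · obtain rfl : l₂ = 0 := by linarith
      rw [add_zero, h₁.target, ← h₂.source, h₂.target]
    · simp [h₂.target]
  · have u1 := h₁.unitSpeed
    have u2 : ∀ᵐ τ ∂(volume.restrict (Ioo l₁ (l₁ + l₂))), DifferentiableAt ℝ γ₂ (-l₁ + τ) ∧
        ‖deriv γ₂ (-l₁ + τ)‖ = 1 :=
      ae_Ioo_comp_add_left (P := fun τ => DifferentiableAt ℝ γ₂ τ ∧ ‖deriv γ₂ τ‖ = 1)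
        (by simpa using h₂.unitSpeed)
    rw [ae_restrict_iff' measurableSet_Ioo] at u1 u2 ⊢
    have h0 : ∀ᵐ τ : ℝ, τ ≠ l₁ := by simp [ae_iff, measure_singleton]
    filter_upwards [u1, u2, h0] with τ v1 v2 hne hτ
    rcases lt_or_gt_of_ne hne with hlt | hgt
    · have he : concatCurve l₁ γ₁ γ₂ =ᶠ[𝓝 τ] γ₁ := by
        filter_upwards [eventually_lt_nhds hlt] with r hr
        simp [concatCurve, hr.le]
      rw [he.deriv_eq, he.differentiableAt_iff]
      exact v1 ⟨hτ.1, hlt⟩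
    · have he : concatCurve l₁ γ₁ γ₂ =ᶠ[𝓝 τ] fun r => γ₂ (-l₁ + r) := by
        filter_upwards [eventually_gt_nhds hgt] with r hr
        simp [concatCurve, not_le.2 hr, sub_eq_neg_add]
      rw [he.deriv_eq, he.differentiableAt_iff, deriv_comp_const_add]
      have := v2 ⟨hgt, hτ.2⟩
      exact ⟨this.1.comp τ (by fun_prop : DifferentiableAt ℝ (fun r => -l₁ + r) τ), this.2⟩

/-- The segment from `a` to `b`, traversed at unit speed. For `a = b` it is the constant path on
`[0, 0]`. -/
theorem of_segment {a b : EuclideanSpace ℝ (Fin n)} (h : segment ℝ a b ⊆ A) :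
    IsUnitSpeedPath A ‖b - a‖ (fun τ => a + (τ / ‖b - a‖) • (b - a)) a b := by
  have hd : ∀ τ : ℝ, HasDerivAt (fun τ : ℝ => a + (τ / ‖b - a‖) • (b - a))
      ((1 / ‖b - a‖) • (b - a)) τ := fun τ =>
    (((hasDerivAt_id τ).div_const _).smul_const (b - a)).const_add a
  refine ⟨norm_nonneg _, ⟨1, ?_⟩, ?_, by simp, ?_, ?_⟩
  · refine LipschitzOnWith.of_dist_le_mul fun c _ d _ => ?_
    simp only [dist_eq_norm, add_sub_add_left_eq_sub, ← sub_smul, ← sub_div, norm_smul, norm_div,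
      norm_norm, NNReal.coe_one, one_mul]
    rcases eq_or_ne ‖b - a‖ 0 with h0 | h0
    · simp [h0]
    · rw [div_mul_cancel₀ _ h0]
  · intro τ hτ
    refine h ?_
    rw [segment_eq_image']
    exact ⟨τ / ‖b - a‖, ⟨div_nonneg hτ.1 (norm_nonneg _),
      div_le_one_of_le₀ hτ.2 (norm_nonneg _)⟩, rfl⟩
  · by_cases hab : ‖b - a‖ = 0
    · have : b = a := by rwa [norm_eq_zero, sub_eq_zero] at hab
      simp [this]
    · simp [div_self hab]
  · rw [ae_restrict_iff' measurableSet_Ioo]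
    refine Eventually.of_forall fun τ hτ => ⟨(hd τ).differentiableAt, ?_⟩
    have : ‖b - a‖ ≠ 0 := (hτ.1.trans hτ.2).ne'
    rw [(hd τ).deriv, norm_smul, norm_div, norm_norm, norm_one, one_div, inv_mul_cancel₀ this]

end IsUnitSpeedPath

theorem finslerLength_concatCurve (hl₁ : 0 ≤ l₁) (hl₂ : 0 ≤ l₂) :
    finslerLength K (l₁ + l₂) (concatCurve l₁ γ₁ γ₂) =
      finslerLength K l₁ γ₁ + finslerLength K l₂ γ₂ := by
  simp only [finslerLength_eq_finslerArc]
  rw [← finslerArc_add_finslerArc hl₁ (le_add_of_nonneg_right hl₂)]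
  congr 1
  · exact finslerArc_congr fun τ hτ => by simp [concatCurve, hτ.2.le]
  · have h1 := finslerArc_comp_add_left (K := K) (γ := γ₂) (-l₁) l₁ (l₁ + l₂)
    rw [neg_add_cancel, neg_add_cancel_left] at h1
    rw [← h1]
    exact finslerArc_congr fun τ hτ => by simp [concatCurve, hτ.1, sub_eq_neg_add]

namespace IsFinslerField

theorem finslerArc_le (h : IsFinslerField Ω K α M) (hγ : IsUnitSpeedPath (closure Ω) l γ x y)
    (hs : 0 ≤ s) (htl : t ≤ l) : finslerArc K γ s t ≤ ENNReal.ofReal (M * (t - s)) := by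
  have hu : ∀ᵐ τ ∂(volume.restrict (Ioo s t)), DifferentiableAt ℝ γ τ ∧ ‖deriv γ τ‖ = 1 :=
    ae_mono (Measure.restrict_mono (Ioo_subset_Ioo hs htl) le_rfl) hγ.unitSpeed
  calc finslerArc K γ s t ≤ ∫⁻ _ in Ioo s t, ENNReal.ofReal M := by
        refine lintegral_mono_ae ?_
        filter_upwards [hu, ae_restrict_mem measurableSet_Ioo] with τ hτ hm
        exact ENNReal.ofReal_le_ofReal (h.supportFun_le_of_norm_eq_one
          (hγ.mapsTo ⟨hs.trans hm.1.le, hm.2.le.trans htl⟩) hτ.2)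
    _ = ENNReal.ofReal (M * (t - s)) := by
        rw [setLIntegral_const, Real.volume_Ioo, ENNReal.ofReal_mul h.outer_pos.le]

theorem finslerLength_le (h : IsFinslerField Ω K α M) (hγ : IsUnitSpeedPath (closure Ω) l γ x y) :
    finslerLength K l γ ≤ ENNReal.ofReal (M * l) := by
  simpa [finslerLength_eq_finslerArc] using h.finslerArc_le hγ le_rfl le_rfl

theorem aemeasurable_supportFun_comp (h : IsFinslerField Ω K α M) {S : Set ℝ}
    (hS : MeasurableSet S) (hγ : ContinuousOn γ S) (hm : MapsTo γ S (closure Ω))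
    {w : ℝ → EuclideanSpace ℝ (Fin n)} (hw : Measurable w) :
    AEMeasurable (fun τ => supportFun K (γ τ) (w τ)) (volume.restrict S) := by
  classical
  let D : Set (EuclideanSpace ℝ (Fin n) × EuclideanSpace ℝ (Fin n)) := closure Ω ×ˢ univ
  have hF : Measurable (D.piecewise (fun z => supportFun K z.1 z.2) fun _ => 0) :=
    h.continuousOn_supportFun.measurable_piecewise continuousOn_const
      (isClosed_closure.prod isClosed_univ).measurableSet
  have hG : AEMeasurable (fun τ => (γ τ, w τ)) (volume.restrict S) :=
    (hγ.aemeasurable hS).prodMk hw.aemeasurable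
  refine (hF.comp_aemeasurable hG).congr ?_
  filter_upwards [ae_restrict_mem hS] with τ hτ
  exact piecewise_eq_of_mem D _ _ ⟨hm hτ, mem_univ _⟩

theorem integrableOn_supportFun_deriv (h : IsFinslerField Ω K α M)
    (hγ : IsUnitSpeedPath (closure Ω) l γ x y) :
    IntegrableOn (fun τ => supportFun K (γ τ) (deriv γ τ)) (Ioo 0 l) := by
  refine Integrable.mono' (g := fun _ => M) (integrable_const _)
    (h.aemeasurable_supportFun_comp measurableSet_Ioo (hγ.continuousOn.mono Ioo_subset_Icc_self)
      (hγ.mapsTo.mono_left Ioo_subset_Icc_self) (measurable_deriv γ)).aestronglyMeasurable ?_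
  filter_upwards [hγ.unitSpeed, ae_restrict_mem measurableSet_Ioo] with τ hτ hm
  have hcl := hγ.mapsTo (Ioo_subset_Icc_self hm)
  rw [Real.norm_of_nonneg (h.supportFun_nonneg hcl)]
  exact h.supportFun_le_of_norm_eq_one hcl hτ.2

theorem ofReal_integral_supportFun (h : IsFinslerField Ω K α M)
    (hγ : IsUnitSpeedPath (closure Ω) l γ x y) (hs : 0 ≤ s) (htl : t ≤ l) :
    ENNReal.ofReal (∫ τ in Ioo s t, supportFun K (γ τ) (deriv γ τ)) = finslerArc K γ s t := by
  have hsub : Ioo s t ⊆ Ioo 0 l := Ioo_subset_Ioo hs htl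
  refine ofReal_integral_eq_lintegral_ofReal ((h.integrableOn_supportFun_deriv hγ).mono_set hsub) ?_
  filter_upwards [ae_restrict_mem measurableSet_Ioo] with τ hτ
  exact h.supportFun_nonneg (hγ.mapsTo (Ioo_subset_Icc_self (hsub hτ)))

end IsFinslerField

end Paths

/-! ### The distance and its extension to the closure -/

section Distance

variable {n : ℕ} {Ω : Set (EuclideanSpace ℝ (Fin n))}
  {K : EuclideanSpace ℝ (Fin n) → Set (EuclideanSpace ℝ (Fin n))} {α M : ℝ}
  {l s t : ℝ} {γ : ℝ → EuclideanSpace ℝ (Fin n)} {x y a b c z : EuclideanSpace ℝ (Fin n)}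

theorem interiorDist_le_finslerLength (h : IsUnitSpeedPath Ω l γ a b) :
    interiorDist Ω K a b ≤ finslerLength K l γ :=
  iInf_le_of_le l (iInf_le_of_le γ (iInf_le _ h))

theorem interiorDist_triangle (a b c : EuclideanSpace ℝ (Fin n)) :
    interiorDist Ω K a c ≤ interiorDist Ω K a b + interiorDist Ω K b c := by
  conv_rhs => unfold interiorDist
  simp only [ENNReal.iInf_add, ENNReal.add_iInf]
  refine le_iInf fun l₂ => le_iInf fun γ₂ => le_iInf fun h₂ =>
    le_iInf fun l₁ => le_iInf fun γ₁ => le_iInf fun h₁ => ?_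
  rw [← finslerLength_concatCurve h₁.length_nonneg h₂.length_nonneg]
  exact interiorDist_le_finslerLength (h₁.concat h₂)

theorem finslerDist_le_liminf {xs ys : ℕ → EuclideanSpace ℝ (Fin n)} (hxs : ∀ k, xs k ∈ Ω)
    (hys : ∀ k, ys k ∈ Ω) (hx : Tendsto xs atTop (𝓝 x)) (hy : Tendsto ys atTop (𝓝 y)) :
    finslerDist Ω K x y ≤ liminf (fun k => interiorDist Ω K (xs k) (ys k)) atTop :=
  iInf_le_of_le xs (iInf_le_of_le ys (iInf_le _ ⟨hxs, hys, hx, hy⟩))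

theorem finslerDist_le_interiorDist (ha : a ∈ Ω) (hb : b ∈ Ω) :
    finslerDist Ω K a b ≤ interiorDist Ω K a b := by
  simpa using finslerDist_le_liminf (K := K) (fun _ => ha) (fun _ => hb)
    tendsto_const_nhds tendsto_const_nhds

theorem exists_interiorDist_lt_of_finslerDist_lt {r : ENNReal} (h : finslerDist Ω K a b < r)
    {V W : Set (EuclideanSpace ℝ (Fin n))} (hV : V ∈ 𝓝 a) (hW : W ∈ 𝓝 b) :
    ∃ a' ∈ V ∩ Ω, ∃ b' ∈ W ∩ Ω, interiorDist Ω K a' b' < r := by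
  simp only [finslerDist, iInf_lt_iff] at h
  obtain ⟨xs, ys, ⟨hxs, hys, hx, hy⟩, hlt⟩ := h
  obtain ⟨k, hk, hkV, hkW⟩ := ((frequently_lt_of_liminf_lt (h := hlt)).and_eventually
    ((hx.eventually hV).and (hy.eventually hW))).exists
  exact ⟨xs k, ⟨hkV, hxs k⟩, ys k, ⟨hkW, hys k⟩, hk⟩

theorem finslerDist_le_of_forall_nhds {r : ENNReal}
    (h : ∀ V ∈ 𝓝 a, ∀ W ∈ 𝓝 b, ∃ a' ∈ V ∩ Ω, ∃ b' ∈ W ∩ Ω, interiorDist Ω K a' b' ≤ r) :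
    finslerDist Ω K a b ≤ r := by
  have hpos : ∀ k : ℕ, (0 : ℝ) < 1 / ((k : ℝ) + 1) := fun k => Nat.one_div_pos_of_nat
  choose xs hxs ys hys hr using fun k : ℕ =>
    h _ (Metric.ball_mem_nhds a (hpos k)) _ (Metric.ball_mem_nhds b (hpos k))
  have lim : ∀ {w : EuclideanSpace ℝ (Fin n)} {ws : ℕ → EuclideanSpace ℝ (Fin n)},
      (∀ k : ℕ, ws k ∈ Metric.ball w (1 / ((k : ℝ) + 1))) → Tendsto ws atTop (𝓝 w) := fun hw =>
    tendsto_iff_dist_tendsto_zero.2 (squeeze_zero (fun _ => dist_nonneg)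
      (fun k => (Metric.mem_ball.1 (hw k)).le) tendsto_one_div_add_atTop_nhds_zero_nat)
  refine (finslerDist_le_liminf (fun k => (hxs k).2) (fun k => (hys k).2)
    (lim fun k => (hxs k).1) (lim fun k => (hys k).1)).trans ?_
  exact (liminf_le_liminf (Eventually.of_forall hr)).trans (liminf_const r).le

/-- Near a boundary point a Lipschitz domain is stable under a cone of directions: displacing a point
of the closure by `w + t • e`, with `t` large compared with `‖w‖`, leads into the domain. -/
theorem HasLipschitzBoundary.exists_cone (hlip : HasLipschitzBoundary Ω) (hz : z ∈ frontier Ω) :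
    ∃ (e : EuclideanSpace ℝ (Fin n)) (C R : ℝ), ‖e‖ = 1 ∧ 0 ≤ C ∧ 0 < R ∧
      ∀ x ∈ closure Ω, x ∈ Metric.ball z R → ∀ w : EuclideanSpace ℝ (Fin n), ∀ t : ℝ,
        C * ‖w‖ < t → x + w + t • e ∈ Metric.ball z R → x + w + t • e ∈ Ω := by
  obtain ⟨e, f, C, U, he, hf, hU, hzU, hΩ⟩ := hlip z hz
  obtain ⟨R, hR, hRU⟩ := Metric.isOpen_iff.1 hU z hzU
  refine ⟨e, 2 * C + 1, R, he, by positivity, hR, fun x hx hxR w t ht hm => ?_⟩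
  have hee : (inner ℝ e e : ℝ) = 1 := by rw [real_inner_self_eq_norm_sq, he, one_pow]
  -- On the closure the strict inequality defining `Ω` in the chart becomes a weak one.
  have hx' : f (x - (inner ℝ e x : ℝ) • e) ≤ inner ℝ e x := by
    have hcl : IsClosed {y | f (y - (inner ℝ e y : ℝ) • e) ≤ inner ℝ e y} :=
      isClosed_le (hf.continuous.comp (by fun_prop)) (by fun_prop)
    have hsub : U ∩ Ω ⊆ {y | f (y - (inner ℝ e y : ℝ) • e) ≤ inner ℝ e y} :=
      fun y hy => ((hΩ y hy.1).1 hy.2).le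
    exact closure_minimal hsub hcl (hU.inter_closure ⟨hRU hxR, hx⟩)
  rw [hΩ _ (hRU hm)]
  have hv : (inner ℝ e (x + w + t • e) : ℝ) = inner ℝ e x + inner ℝ e w + t := by
    rw [inner_add_right, inner_add_right, inner_smul_right, hee, mul_one]
  have hh : x + w + t • e - (inner ℝ e (x + w + t • e) : ℝ) • e =
      (x - (inner ℝ e x : ℝ) • e) + (w - (inner ℝ e w : ℝ) • e) := by
    rw [hv]; module
  have hew : |(inner ℝ e w : ℝ)| ≤ ‖w‖ := by simpa [he] using abs_real_inner_le_norm e w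
  have hw : ‖w - (inner ℝ e w : ℝ) • e‖ ≤ 2 * ‖w‖ := by
    refine (norm_sub_le _ _).trans ?_
    rw [norm_smul, he, mul_one, Real.norm_eq_abs]
    linarith
  have hfl : f ((x - (inner ℝ e x : ℝ) • e) + (w - (inner ℝ e w : ℝ) • e)) ≤
      f (x - (inner ℝ e x : ℝ) • e) + C * (2 * ‖w‖) := by
    have := hf.le_add_mul ((x - (inner ℝ e x : ℝ) • e) + (w - (inner ℝ e w : ℝ) • e))
      (x - (inner ℝ e x : ℝ) • e)
    rw [dist_eq_norm, add_sub_cancel_left] at this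
    exact this.trans (by gcongr)
  rw [hh, hv]
  have := (abs_le.1 hew).1
  linarith

namespace IsFinslerField

theorem interiorDist_le_of_segment (h : IsFinslerField Ω K α M) (hs : segment ℝ a b ⊆ Ω) :
    interiorDist Ω K a b ≤ ENNReal.ofReal (M * ‖b - a‖) :=
  (interiorDist_le_finslerLength (IsUnitSpeedPath.of_segment hs)).trans
    (h.finslerLength_le (IsUnitSpeedPath.of_segment (hs.trans subset_closure)))

/-- Two points of `Ω` near a boundary point are joined by three segments in `Ω`: up along the axis of
the cone, across, and down again. -/
theorem interiorDist_le_of_cone (h : IsFinslerField Ω K α M) {e : EuclideanSpace ℝ (Fin n)}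
    {C R r : ℝ} (he : ‖e‖ = 1) (hC : 0 ≤ C) (hr : 0 < r) (hR : (2 * C + 2) * r ≤ R)
    (hcone : ∀ x ∈ closure Ω, x ∈ Metric.ball z R → ∀ w : EuclideanSpace ℝ (Fin n), ∀ t : ℝ,
        C * ‖w‖ < t → x + w + t • e ∈ Metric.ball z R → x + w + t • e ∈ Ω)
    (ha : a ∈ Metric.ball z r ∩ Ω) (hb : b ∈ Metric.ball z r ∩ Ω) :
    interiorDist Ω K a b ≤ ENNReal.ofReal (M * ((4 * C + 4) * r)) := by
  -- At this height the horizontal segment stays within the cones of its endpoints.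
  set H : ℝ := 2 * C * r + r with hH
  have hH0 : 0 < H := by positivity
  have hrR : r ≤ R := by nlinarith [mul_nonneg hC hr.le]
  have hball : ∀ c ∈ Metric.ball z r, ∀ τ ∈ Icc 0 H, c + τ • e ∈ Metric.ball z R := by
    intro c hc τ hτ
    rw [mem_ball_iff_norm] at hc ⊢
    have h1 : ‖c + τ • e - z‖ ≤ ‖c - z‖ + ‖τ • e‖ := by
      rw [add_sub_right_comm]; exact norm_add_le _ _
    rw [norm_smul, he, mul_one, Real.norm_of_nonneg hτ.1] at h1
    linarith [hτ.2]
  have hup : ∀ c ∈ Metric.ball z r ∩ Ω, ∀ τ ∈ Icc 0 H, c + τ • e ∈ Ω := by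
    intro c hc τ hτ
    rcases hτ.1.eq_or_lt with h0 | h0
    · simpa [← h0] using hc.2
    · have := hcone c (subset_closure hc.2) (Metric.ball_subset_ball hrR hc.1) 0 τ (by simpa using h0)
      rw [add_zero] at this
      exact this (hball c hc.1 τ hτ)
  have hvert : ∀ c ∈ Metric.ball z r ∩ Ω, segment ℝ c (c + H • e) ⊆ Ω := by
    intro c hc
    rw [segment_eq_image']
    rintro _ ⟨θ, hθ, rfl⟩
    simp only [add_sub_cancel_left, smul_smul]
    exact hup c hc _ ⟨mul_nonneg hθ.1 hH0.le, mul_le_of_le_one_left hH0.le hθ.2⟩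
  have hvd : ∀ c : EuclideanSpace ℝ (Fin n), ‖c + H • e - c‖ = H := by
    intro c
    rw [add_sub_cancel_left, norm_smul, he, mul_one, Real.norm_of_nonneg hH0.le]
  have hab : ‖b - a‖ < 2 * r := by
    have h1 := mem_ball_iff_norm.1 ha.1
    have h2 := mem_ball_iff_norm.1 hb.1
    have h3 : ‖b - a‖ ≤ ‖b - z‖ + ‖a - z‖ := by
      simpa using norm_sub_le (b - z) (a - z)
    linarith
  have hhor : segment ℝ (a + H • e) (b + H • e) ⊆ Ω := by
    rw [segment_eq_image']
    rintro _ ⟨θ, hθ, rfl⟩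
    have hc : a + θ • (b - a) ∈ Metric.ball z r := by
      refine (convex_ball z r).segment_subset ha.1 hb.1 ?_
      rw [segment_eq_image']
      exact ⟨θ, hθ, rfl⟩
    have heq : a + H • e + θ • (b + H • e - (a + H • e)) = a + θ • (b - a) + H • e := by module
    simp only [heq]
    refine hcone a (subset_closure ha.2) (Metric.ball_subset_ball hrR ha.1) _ _ ?_
      (hball _ hc H ⟨hH0.le, le_rfl⟩)
    have h1 : ‖θ • (b - a)‖ ≤ 2 * r := by
      rw [norm_smul, Real.norm_of_nonneg hθ.1]
      exact (mul_le_of_le_one_left (norm_nonneg _) hθ.2).trans hab.le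
    nlinarith [mul_le_mul_of_nonneg_left h1 hC]
  have d1 := h.interiorDist_le_of_segment (hvert a ha)
  have d2 := h.interiorDist_le_of_segment hhor
  have d3 := h.interiorDist_le_of_segment ((segment_symm ℝ _ _).trans_subset (hvert b hb))
  rw [hvd] at d1
  rw [norm_sub_rev, hvd] at d3
  rw [add_sub_add_right_eq_sub] at d2
  have hM := h.outer_pos
  calc interiorDist Ω K a b
      ≤ interiorDist Ω K a (a + H • e) + (interiorDist Ω K (a + H • e) (b + H • e) +
          interiorDist Ω K (b + H • e) b) :=
        (interiorDist_triangle _ _ _).trans (by gcongr; exact interiorDist_triangle _ _ _)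
    _ ≤ ENNReal.ofReal (M * H) + (ENNReal.ofReal (M * ‖b - a‖) + ENNReal.ofReal (M * H)) := by
        gcongr
    _ = ENNReal.ofReal (M * H + (M * ‖b - a‖ + M * H)) := by
        rw [ENNReal.ofReal_add, ENNReal.ofReal_add] <;> positivity
    _ ≤ ENNReal.ofReal (M * ((4 * C + 4) * r)) := by
        refine ENNReal.ofReal_le_ofReal ?_
        rw [← mul_add, ← mul_add]
        refine mul_le_mul_of_nonneg_left ?_ hM.le
        rw [hH]
        linarith

/-- Points of `Ω` close to a common point of the closure are close for the interior distance. At the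
boundary this is where the Lipschitz regularity enters: one moves up, across, and down. -/
theorem exists_nhds_interiorDist_le (h : IsFinslerField Ω K α M) (hopen : IsOpen Ω)
    (hlip : HasLipschitzBoundary Ω) (hz : z ∈ closure Ω) {ε : ℝ} (hε : 0 < ε) :
    ∃ V ∈ 𝓝 z, ∀ a ∈ V ∩ Ω, ∀ b ∈ V ∩ Ω, interiorDist Ω K a b ≤ ENNReal.ofReal ε := by
  have hM := h.outer_pos
  by_cases hzΩ : z ∈ Ω
  · obtain ⟨R, hR, hRΩ⟩ := Metric.isOpen_iff.1 hopen z hzΩ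
    refine ⟨Metric.ball z (min R (ε / (2 * M))), Metric.ball_mem_nhds _ (by positivity),
      fun a ha b hb => ?_⟩
    refine (h.interiorDist_le_of_segment (((convex_ball z _).segment_subset ha.1 hb.1).trans
      ((Metric.ball_subset_ball (min_le_left _ _)).trans hRΩ))).trans
        (ENNReal.ofReal_le_ofReal ?_)
    have h1 := (mem_ball_iff_norm.1 ha.1).trans_le (min_le_right _ _)
    have h2 := (mem_ball_iff_norm.1 hb.1).trans_le (min_le_right _ _)
    have h3 : ‖b - a‖ ≤ ‖b - z‖ + ‖a - z‖ := by
      simpa using norm_sub_le (b - z) (a - z)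
    have h4 : ‖b - a‖ ≤ 2 * (ε / (2 * M)) := by linarith
    calc M * ‖b - a‖ ≤ M * (2 * (ε / (2 * M))) := by gcongr
      _ = ε := by field_simp
  · have hzf : z ∈ frontier Ω := by
      rw [hopen.frontier_eq]; exact ⟨hz, hzΩ⟩
    obtain ⟨e, C, R, he, hC, hR, hcone⟩ := hlip.exists_cone hzf
    have hr : 0 < min (R / (2 * C + 2)) (ε / (M * (4 * C + 4))) := by positivity
    refine ⟨Metric.ball z _, Metric.ball_mem_nhds _ hr, fun a ha b hb => ?_⟩
    refine (h.interiorDist_le_of_cone he hC hr ?_ hcone ha hb).trans (ENNReal.ofReal_le_ofReal ?_)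
    · rw [mul_comm, ← le_div_iff₀ (by positivity)]
      exact min_le_left _ _
    · rw [← mul_assoc, mul_comm, ← le_div_iff₀ (by positivity)]
      exact min_le_right _ _

theorem finslerDist_triangle (h : IsFinslerField Ω K α M) (hopen : IsOpen Ω)
    (hlip : HasLipschitzBoundary Ω) (hb : b ∈ closure Ω) :
    finslerDist Ω K a c ≤ finslerDist Ω K a b + finslerDist Ω K b c := by
  by_cases h1 : finslerDist Ω K a b = ⊤
  · simp [h1]
  by_cases h2 : finslerDist Ω K b c = ⊤
  · simp [h2]
  refine ENNReal.le_of_forall_pos_le_add fun ε hε _ => ?_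
  have hε3 : (0 : ℝ) < ε / 3 := by positivity
  have hε3' : ENNReal.ofReal (ε / 3) ≠ 0 := by simpa using hε
  obtain ⟨N, hN, hNd⟩ := h.exists_nhds_interiorDist_le hopen hlip hb hε3
  refine finslerDist_le_of_forall_nhds fun V hV W hW => ?_
  obtain ⟨a', ha', b₁, hb₁, hd₁⟩ := exists_interiorDist_lt_of_finslerDist_lt
    (ENNReal.lt_add_right h1 hε3') hV hN
  obtain ⟨b₂, hb₂, c', hc', hd₂⟩ := exists_interiorDist_lt_of_finslerDist_lt
    (ENNReal.lt_add_right h2 hε3') hN hW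
  refine ⟨a', ha', c', hc', ?_⟩
  calc interiorDist Ω K a' c'
      ≤ interiorDist Ω K a' b₁ + (interiorDist Ω K b₁ b₂ + interiorDist Ω K b₂ c') :=
        (interiorDist_triangle _ _ _).trans (by gcongr; exact interiorDist_triangle _ _ _)
    _ ≤ (finslerDist Ω K a b + ENNReal.ofReal (ε / 3)) + (ENNReal.ofReal (ε / 3) +
          (finslerDist Ω K b c + ENNReal.ofReal (ε / 3))) :=
        add_le_add hd₁.le (add_le_add (hNd _ hb₁ _ hb₂) hd₂.le)
    _ = finslerDist Ω K a b + finslerDist Ω K b c + (ENNReal.ofReal (ε / 3) +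
          ENNReal.ofReal (ε / 3) + ENNReal.ofReal (ε / 3)) := by ring
    _ = finslerDist Ω K a b + finslerDist Ω K b c + ε := by
        rw [← ENNReal.ofReal_add hε3.le hε3.le, ← ENNReal.ofReal_add (by positivity) hε3.le,
          add_thirds, ENNReal.ofReal_coe_nnreal]

/-- The lengths of small translates of an arc, as long as they stay in the closure, converge to the
length of the arc: the velocity is unchanged and the support function is continuous. -/
theorem tendsto_finslerArc_translate (h : IsFinslerField Ω K α M)
    (hγ : IsUnitSpeedPath (closure Ω) l γ x y) (hs : 0 ≤ s) (htl : t ≤ l)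
    {v : ℕ → EuclideanSpace ℝ (Fin n)} (hv : Tendsto v atTop (𝓝 0))
    (hm : ∀ k, ∀ τ ∈ Icc s t, γ τ + v k ∈ closure Ω) :
    Tendsto (fun k => finslerArc K (fun τ => γ τ + v k) s t) atTop (𝓝 (finslerArc K γ s t)) := by
  unfold finslerArc
  simp only [deriv_add_const]
  have hsub : Ioo s t ⊆ Icc 0 l := fun τ hτ => ⟨hs.trans hτ.1.le, hτ.2.le.trans htl⟩
  have hu : ∀ᵐ τ ∂(volume.restrict (Ioo s t)), DifferentiableAt ℝ γ τ ∧ ‖deriv γ τ‖ = 1 :=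
    ae_mono (Measure.restrict_mono (Ioo_subset_Ioo hs htl) le_rfl) hγ.unitSpeed
  refine tendsto_lintegral_of_dominated_convergence' (fun _ => ENNReal.ofReal M) ?_ ?_ ?_ ?_
  · intro k
    exact (h.aemeasurable_supportFun_comp measurableSet_Ioo
      ((hγ.continuousOn.mono hsub).add continuousOn_const)
      (fun τ hτ => hm k τ (Ioo_subset_Icc_self hτ)) (measurable_deriv γ)).ennreal_ofReal
  · intro k
    filter_upwards [hu, ae_restrict_mem measurableSet_Ioo] with τ hτ hmem
    exact ENNReal.ofReal_le_ofReal
      (h.supportFun_le_of_norm_eq_one (hm k τ (Ioo_subset_Icc_self hmem)) hτ.2)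
  · simp [ENNReal.mul_eq_top]
  · filter_upwards [ae_restrict_mem measurableSet_Ioo] with τ hτ
    refine (ENNReal.continuous_ofReal.tendsto _).comp ?_
    have h1 : Tendsto (fun k => γ τ + v k) atTop (𝓝[closure Ω] (γ τ)) := by
      refine tendsto_nhdsWithin_iff.2 ⟨?_, Eventually.of_forall fun k =>
        hm k τ (Ioo_subset_Icc_self hτ)⟩
      simpa using hv.const_add (γ τ)
    exact (h.continuousOn_supportFun_left (deriv γ τ) (γ τ) (hγ.mapsTo (hsub hτ))).tendsto.comp h1

/-- A path in the closure dominates the distance locally. In the interior this is immediate; at a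
boundary point the arc is pushed inside along the axis of the cone. -/
theorem exists_finslerDist_le_finslerArc (h : IsFinslerField Ω K α M) (hopen : IsOpen Ω)
    (hlip : HasLipschitzBoundary Ω) (hγ : IsUnitSpeedPath (closure Ω) l γ x y)
    {τ₀ : ℝ} (hτ₀ : τ₀ ∈ Icc 0 l) :
    ∃ δ > 0, ∀ s ∈ Icc 0 l, ∀ t ∈ Icc 0 l, s ≤ t → s ∈ Metric.ball τ₀ δ → t ∈ Metric.ball τ₀ δ →
      finslerDist Ω K (γ s) (γ t) ≤ finslerArc K γ s t := by
  have hnear : ∀ V ∈ 𝓝 (γ τ₀), ∃ δ > 0, ∀ s ∈ Icc 0 l, ∀ t ∈ Icc 0 l, s ∈ Metric.ball τ₀ δ →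
      t ∈ Metric.ball τ₀ δ → ∀ τ ∈ Icc s t, γ τ ∈ V := by
    intro V hV
    obtain ⟨δ, hδ, hsub⟩ := Metric.mem_nhdsWithin_iff.1 (hγ.continuousOn τ₀ hτ₀ hV)
    refine ⟨δ, hδ, fun s hs t ht hsδ htδ τ hτ => hsub ⟨?_, hs.1.trans hτ.1, hτ.2.trans ht.2⟩⟩
    exact (convex_ball τ₀ δ).ordConnected.out hsδ htδ hτ
  by_cases hΩ : γ τ₀ ∈ Ω
  · obtain ⟨δ, hδ, hV⟩ := hnear Ω (hopen.mem_nhds hΩ)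
    refine ⟨δ, hδ, fun s hs t ht hst hsδ htδ => ?_⟩
    have hin := hV s hs t ht hsδ htδ
    have hp := hγ.arc hs.1 hst ht.2 hin
    refine (finslerDist_le_interiorDist (hin s ⟨le_rfl, hst⟩) (hin t ⟨hst, le_rfl⟩)).trans
      ((interiorDist_le_finslerLength hp).trans_eq ?_)
    rw [finslerLength_eq_finslerArc, finslerArc_comp_add_left, add_zero, add_sub_cancel]
  · have hzf : γ τ₀ ∈ frontier Ω := by
      rw [hopen.frontier_eq]; exact ⟨hγ.mapsTo hτ₀, hΩ⟩
    obtain ⟨e, C, R, he, hC, hR, hcone⟩ := hlip.exists_cone hzf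
    obtain ⟨δ, hδ, hV⟩ := hnear (Metric.ball (γ τ₀) (R / 2)) (Metric.ball_mem_nhds _ (by positivity))
    refine ⟨δ, hδ, fun s hs t ht hst hsδ htδ => ?_⟩
    have hin := hV s hs t ht hsδ htδ
    set ε : ℕ → ℝ := fun k => R / 2 * (1 / ((k : ℝ) + 1)) with hε
    have hε0 : ∀ k, 0 < ε k := fun k => mul_pos (by positivity) Nat.one_div_pos_of_nat
    have hεR : ∀ k, ε k ≤ R / 2 := fun k =>
      mul_le_of_le_one_right (by positivity) (by
        rw [div_le_one (by positivity)]; exact le_add_of_nonneg_left k.cast_nonneg)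
    have hεlim : Tendsto (fun k => ε k • e) atTop (𝓝 0) := by
      have : Tendsto ε atTop (𝓝 (R / 2 * 0)) :=
        tendsto_one_div_add_atTop_nhds_zero_nat.const_mul (R / 2)
      simpa using this.smul_const e
    have hpush : ∀ k, ∀ τ ∈ Icc s t, γ τ + ε k • e ∈ Ω := by
      intro k τ hτ
      have hb := mem_ball_iff_norm.1 (hin τ hτ)
      have := hcone (γ τ) (hγ.mapsTo ⟨hs.1.trans hτ.1, hτ.2.trans ht.2⟩)
        (Metric.ball_subset_ball (by linarith) (hin τ hτ)) 0 (ε k) (by simpa using hε0 k)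
      rw [add_zero] at this
      refine this ?_
      rw [mem_ball_iff_norm, add_sub_right_comm]
      refine (norm_add_le _ _).trans_lt ?_
      rw [norm_smul, he, mul_one, Real.norm_of_nonneg (hε0 k).le]
      linarith [hεR k]
    have hle : ∀ k, interiorDist Ω K (γ s + ε k • e) (γ t + ε k • e) ≤
        finslerArc K (fun τ => γ τ + ε k • e) s t := by
      intro k
      refine (interiorDist_le_finslerLength
        (hγ.translate_arc hs.1 hst ht.2 (ε k • e) (hpush k))).trans_eq ?_
      rw [finslerLength_eq_finslerArc,
        finslerArc_comp_add_left (γ := fun τ => γ τ + ε k • e), add_zero, add_sub_cancel]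
    have hlim := h.tendsto_finslerArc_translate hγ hs.1 ht.2 hεlim
      fun k τ hτ => subset_closure (hpush k τ hτ)
    calc finslerDist Ω K (γ s) (γ t)
        ≤ liminf (fun k => interiorDist Ω K (γ s + ε k • e) (γ t + ε k • e)) atTop :=
          finslerDist_le_liminf (fun k => hpush k s ⟨le_rfl, hst⟩)
            (fun k => hpush k t ⟨hst, le_rfl⟩)
            (by simpa using hεlim.const_add (γ s)) (by simpa using hεlim.const_add (γ t))
      _ ≤ liminf (fun k => finslerArc K (fun τ => γ τ + ε k • e) s t) atTop :=
          liminf_le_liminf (Eventually.of_forall hle)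
      _ = finslerArc K γ s t := hlim.liminf_eq

/-- The length of an arc of a path in the closure dominates the distance of its endpoints. -/
theorem finslerDist_le_finslerArc (h : IsFinslerField Ω K α M) (hopen : IsOpen Ω)
    (hlip : HasLipschitzBoundary Ω) (hγ : IsUnitSpeedPath (closure Ω) l γ x y)
    (hs : 0 ≤ s) (hst : s ≤ t) (htl : t ≤ l) :
    finslerDist Ω K (γ s) (γ t) ≤ finslerArc K γ s t := by
  choose! δ hδ hloc using fun τ₀ hτ₀ =>
    h.exists_finslerDist_le_finslerArc hopen hlip hγ (τ₀ := τ₀) hτ₀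
  obtain ⟨ρ, hρ, hleb⟩ := lebesgue_number_lemma_of_metric (isCompact_Icc (a := (0 : ℝ)) (b := l))
    (c := fun τ : Icc 0 l => Metric.ball (τ : ℝ) (δ τ)) (fun _ => Metric.isOpen_ball)
    fun τ hτ => mem_iUnion.2 ⟨⟨τ, hτ⟩, Metric.mem_ball_self (hδ τ hτ)⟩
  have hshort : ∀ s ∈ Icc 0 l, ∀ t ∈ Icc 0 l, s ≤ t → t - s < ρ →
      finslerDist Ω K (γ s) (γ t) ≤ finslerArc K γ s t := by
    intro s hs t ht hst hlt
    obtain ⟨τ₀, hτ₀⟩ := hleb s hs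
    refine hloc τ₀ τ₀.2 s hs t ht hst (hτ₀ (Metric.mem_ball_self hρ)) (hτ₀ ?_)
    rwa [Metric.mem_ball, Real.dist_eq, abs_of_nonneg (sub_nonneg.2 hst)]
  -- Splitting off a final arc of length at most `ρ / 2` reduces `k + 1` to `k`.
  have hind : ∀ (k : ℕ), ∀ s ∈ Icc 0 l, ∀ t ∈ Icc 0 l, s ≤ t → t - s ≤ k * (ρ / 2) →
      finslerDist Ω K (γ s) (γ t) ≤ finslerArc K γ s t := by
    intro k
    induction k with
    | zero =>
      intro s hs t ht hst hle
      refine hshort s hs t ht hst (hle.trans_lt ?_)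
      simpa using hρ
    | succ k ih =>
      intro s hs t ht hst hle
      have hsm : s ≤ max s (t - ρ / 2) := le_max_left _ _
      have hmt : max s (t - ρ / 2) ≤ t := max_le hst (by linarith)
      have hm : max s (t - ρ / 2) ∈ Icc 0 l := ⟨hs.1.trans hsm, hmt.trans ht.2⟩
      have h1 := ih s hs _ hm hsm (by
        push_cast at hle
        rw [sub_le_iff_le_add]
        exact max_le (le_add_of_nonneg_left (by positivity)) (by linarith))
      have h2 := hshort _ hm t ht hmt (by linarith [le_max_right s (t - ρ / 2)])
      refine (h.finslerDist_triangle hopen hlip (hγ.mapsTo hm)).trans ((add_le_add h1 h2).trans_eq ?_)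
      exact finslerArc_add_finslerArc hsm hmt
  obtain ⟨k, hk⟩ := exists_nat_ge ((t - s) / (ρ / 2))
  exact hind k s ⟨hs, hst.trans htl⟩ t ⟨hs.trans hst, htl⟩ hst ((div_le_iff₀ (by positivity)).1 hk)

end IsFinslerField

end Distance

/-! ### Solutions are 1-Lipschitz for the distance -/

section Solutions

variable {n : ℕ} {Ω : Set (EuclideanSpace ℝ (Fin n))}
  {K : EuclideanSpace ℝ (Fin n) → Set (EuclideanSpace ℝ (Fin n))} {α M : ℝ}
  {l : ℝ} {γ : ℝ → EuclideanSpace ℝ (Fin n)} {a b x y z : EuclideanSpace ℝ (Fin n)}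
  {g u ρ : EuclideanSpace ℝ (Fin n) → ℝ} {v : EuclideanSpace ℝ (Fin n) → EuclideanSpace ℝ (Fin n)}

/-- The convolution of the kernel `ρ` with `u`, extended by zero outside `Ω`. -/
noncomputable def mollification (Ω : Set (EuclideanSpace ℝ (Fin n)))
    (u ρ : EuclideanSpace ℝ (Fin n) → ℝ) : EuclideanSpace ℝ (Fin n) → ℝ :=
  convolution (Ω.indicator u) ρ (ContinuousLinearMap.lsmul ℝ ℝ) volume

theorem integrable_indicator_of_memLp_top (hopen : IsOpen Ω) (hbdd : Bornology.IsBounded Ω)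
    (hu : MemLp u ⊤ (volume.restrict Ω)) : Integrable (Ω.indicator u) := by
  have : IsFiniteMeasure (volume.restrict Ω) := ⟨by simpa using hbdd.measure_lt_top⟩
  exact (integrable_indicator_iff hopen.measurableSet).2 (hu.integrable le_top)

theorem exists_lipschitzWith_mollification (hopen : IsOpen Ω) (hbdd : Bornology.IsBounded Ω)
    (hu : MemLp u ⊤ (volume.restrict Ω)) (hρ : ContDiff ℝ (⊤ : ℕ∞) ρ) (hρc : HasCompactSupport ρ) :
    ∃ C, LipschitzWith C (mollification Ω u ρ) := by
  have hc : HasCompactSupport (Ω.indicator u) :=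
    HasCompactSupport.of_support_subset_isCompact hbdd.isCompact_closure
      (support_indicator_subset.trans subset_closure)
  exact ContDiff.lipschitzWith_of_hasCompactSupport (n := (⊤ : ℕ∞))
    (HasCompactSupport.convolution _ hc hρc)
    (hρc.contDiff_convolution_right _
      (integrable_indicator_of_memLp_top hopen hbdd hu).locallyIntegrable hρ) (by simp)

/-- Away from the boundary, mollification commutes with the weak gradient. -/
theorem IsWeakGradient.hasFDerivAt_mollification (hv : IsWeakGradient Ω u v) (hopen : IsOpen Ω)
    (hbdd : Bornology.IsBounded Ω) (hu : MemLp u ⊤ (volume.restrict Ω))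
    (hρ : ContDiff ℝ (⊤ : ℕ∞) ρ) (hρc : HasCompactSupport ρ)
    (hsupp : tsupport (fun y => ρ (x - y)) ⊆ Ω) :
    ∃ L : EuclideanSpace ℝ (Fin n) →L[ℝ] ℝ, HasFDerivAt (mollification Ω u ρ) L x ∧
      ∀ q, L q = ∫ y in Ω, (inner ℝ (v y) q : ℝ) * ρ (x - y) := by
  have hi := (integrable_indicator_of_memLp_top hopen hbdd hu).locallyIntegrable
  have hρ1 : ContDiff ℝ 1 ρ := hρ.of_le (by simp)
  refine ⟨_, hρc.hasFDerivAt_convolution_right (ContinuousLinearMap.lsmul ℝ ℝ) hi hρ1 x,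
    fun q => ?_⟩
  rw [convolution_precompR_apply _ hi (hρc.fderiv ℝ) (hρ1.continuous_fderiv one_ne_zero),
    convolution_def]
  have hη : ContDiff ℝ (⊤ : ℕ∞) (fun y => ρ (x - y)) := hρ.comp (contDiff_const.sub contDiff_id)
  have hηc : HasCompactSupport (fun y => ρ (x - y)) :=
    hρc.comp_homeomorph (Homeomorph.subLeft x)
  have hη' : ∀ y, fderiv ℝ (fun y => ρ (x - y)) y q = - fderiv ℝ ρ (x - y) q := by
    intro y
    have h1 : HasFDerivAt (fun y => x - y) (-(ContinuousLinearMap.id ℝ _)) y :=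
      (hasFDerivAt_id y).const_sub x
    have h2 := ((hρ1.differentiable one_ne_zero (x - y)).hasFDerivAt).comp y h1
    have h3 : fderiv ℝ (fun y => ρ (x - y)) y = _ := h2.fderiv
    rw [h3]
    simp
  have hw := hv _ hη hηc hsupp q
  simp only [hη', mul_neg, integral_neg, neg_inj] at hw
  rw [← hw, ← integral_indicator hopen.measurableSet]
  refine integral_congr_ae (Eventually.of_forall fun y => ?_)
  by_cases hy : y ∈ Ω <;> simp [hy]

theorem mollification_eq_normed_convolution (φ : ContDiffBump (0 : EuclideanSpace ℝ (Fin n))) :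
    mollification Ω u (φ.normed volume) = convolution (φ.normed volume) (Ω.indicator u)
      (ContinuousLinearMap.lsmul ℝ ℝ) volume := by
  funext x
  rw [mollification, convolution_lsmul, convolution_lsmul_swap]
  simp only [smul_eq_mul, mul_comm]

theorem dist_mollification_le (hopen : IsOpen Ω) (hbdd : Bornology.IsBounded Ω)
    (hu : MemLp u ⊤ (volume.restrict Ω)) (φ : ContDiffBump (0 : EuclideanSpace ℝ (Fin n)))
    (hball : Metric.ball x φ.rOut ⊆ Ω) {ε : ℝ}
    (hε : ∀ y ∈ Metric.ball x φ.rOut, dist (u y) (u x) ≤ ε) :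
    dist (mollification Ω u (φ.normed volume) x) (u x) ≤ ε := by
  have hx : x ∈ Ω := hball (Metric.mem_ball_self φ.rOut_pos)
  rw [mollification_eq_normed_convolution]
  have := ContDiffBump.dist_normed_convolution_le (φ := φ) (μ := volume) (x₀ := x) (ε := ε)
    (integrable_indicator_of_memLp_top hopen hbdd hu).aestronglyMeasurable (fun y hy => by
      simpa [hball hy, hx] using hε y hy)
  simpa [hx] using this

/-- The gradient of a mollified solution is an average of elements of nearby sets `K y`, so it is
controlled by nearby values of the support function. -/
theorem IsSolution.exists_hasFDerivAt_mollification_le (h : IsFinslerField Ω K α M)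
    (hsol : IsSolution Ω K g u) (hopen : IsOpen Ω) (hbdd : Bornology.IsBounded Ω)
    (φ : ContDiffBump (0 : EuclideanSpace ℝ (Fin n)))
    (hball : Metric.closedBall x φ.rOut ⊆ Ω) :
    ∃ L : EuclideanSpace ℝ (Fin n) →L[ℝ] ℝ,
      HasFDerivAt (mollification Ω u (φ.normed volume)) L x ∧
      ∀ q c, (∀ y ∈ Metric.closedBall x φ.rOut, supportFun K y q ≤ c) → L q ≤ c := by
  obtain ⟨v, hvp, hvg, hvK⟩ := hsol.gradient
  set ρ : EuclideanSpace ℝ (Fin n) → ℝ := φ.normed volume with hρdef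
  have hρ : ContDiff ℝ (⊤ : ℕ∞) ρ := φ.contDiff_normed
  have hρc : HasCompactSupport ρ := φ.hasCompactSupport_normed
  have hρ0 : ∀ y, y ∉ Metric.closedBall x φ.rOut → ρ (x - y) = 0 := by
    intro y hy
    by_contra hne
    have : x - y ∈ Function.support ρ := hne
    rw [hρdef, φ.support_normed_eq, mem_ball_zero_iff, ← dist_eq_norm, dist_comm] at this
    exact hy this.le
  have hsupp : tsupport (fun y => ρ (x - y)) ⊆ Ω := by
    refine (closure_minimal ?_ Metric.isClosed_closedBall).trans hball
    intro y hy
    by_contra hn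
    exact hy (hρ0 y hn)
  obtain ⟨L, hL, hLq⟩ := hvg.hasFDerivAt_mollification hopen hbdd hsol.memLp hρ hρc hsupp
  refine ⟨L, hL, fun q c hc => ?_⟩
  have : IsFiniteMeasure (volume.restrict Ω) := ⟨by simpa using hbdd.measure_lt_top⟩
  have hρcont : Continuous fun y => ρ (x - y) := hρ.continuous.comp (by fun_prop)
  have hρi : Integrable fun y => ρ (x - y) := φ.integrable_normed.comp_sub_left x
  obtain ⟨B, hB⟩ := hρc.exists_bound_of_continuous hρ.continuous
  have hint : Integrable (fun y => (inner ℝ (v y) q : ℝ) * ρ (x - y)) (volume.restrict Ω) :=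
    ((hvp.integrable le_top).inner_const q).mul_bdd (c := B) hρcont.aestronglyMeasurable
      (Eventually.of_forall fun y => hB _)
  rw [hLq]
  calc ∫ y in Ω, (inner ℝ (v y) q : ℝ) * ρ (x - y) ≤ ∫ y in Ω, c * ρ (x - y) := by
        refine integral_mono_ae hint (hρi.integrableOn.const_mul c) ?_
        filter_upwards [hvK, ae_restrict_mem hopen.measurableSet] with y hy hyΩ
        by_cases hyb : y ∈ Metric.closedBall x φ.rOut
        · exact mul_le_mul_of_nonneg_right
            ((h.inner_le_supportFun (subset_closure hyΩ) hy).trans (hc y hyb))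
            (φ.nonneg_normed _)
        · simp [hρ0 y hyb]
    _ = c * ∫ y, ρ (x - y) := by
        rw [integral_const_mul, setIntegral_eq_integral_of_forall_compl_eq_zero]
        exact fun y hy => hρ0 y fun hyb => hy (hball hyb)
    _ = c := by
        rw [integral_sub_left_eq_self ρ volume x, hρdef, φ.integral_normed, mul_one]

theorem IsFinslerField.exists_supportFun_le_add (h : IsFinslerField Ω K α M)
    (hbdd : Bornology.IsBounded Ω) {ε : ℝ} (hε : 0 < ε) :
    ∃ δ > 0, ∀ x ∈ closure Ω, ∀ y ∈ closure Ω, dist y x < δ →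
      ∀ q : EuclideanSpace ℝ (Fin n), ‖q‖ = 1 → supportFun K y q ≤ supportFun K x q + ε := by
  have hc : IsCompact (closure Ω ×ˢ Metric.sphere (0 : EuclideanSpace ℝ (Fin n)) 1) :=
    hbdd.isCompact_closure.prod (isCompact_sphere _ _)
  have hu := hc.uniformContinuousOn_of_continuous
    (h.continuousOn_supportFun.mono (prod_mono_right (subset_univ _)))
  obtain ⟨δ, hδ, hd⟩ := Metric.uniformContinuousOn_iff.1 hu ε hε
  refine ⟨δ, hδ, fun x hx y hy hxy q hq => ?_⟩
  have := hd (y, q) ⟨hy, by simpa using hq⟩ (x, q) ⟨hx, by simpa using hq⟩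
    (by simpa [Prod.dist_eq, hδ] using hxy)
  rw [Real.dist_eq] at this
  linarith [(abs_lt.1 this).2]

/-- Along a path in `Ω` a solution grows at most by the Finslerian length: this holds up to `ε` for
its mollifications, by the chain rule and the fundamental theorem of calculus. -/
theorem IsSolution.sub_le_integral (h : IsFinslerField Ω K α M) (hsol : IsSolution Ω K g u)
    (hopen : IsOpen Ω) (hbdd : Bornology.IsBounded Ω) (hγ : IsUnitSpeedPath Ω l γ a b) :
    u b - u a ≤ ∫ τ in Ioo 0 l, supportFun K (γ τ) (deriv γ τ) := by
  have hγ' : IsUnitSpeedPath (closure Ω) l γ a b := hγ.mono_set subset_closure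
  have hl := hγ.length_nonneg
  have ha : a ∈ Ω := hγ.source ▸ hγ.mapsTo ⟨le_rfl, hl⟩
  have hb : b ∈ Ω := hγ.target ▸ hγ.mapsTo ⟨hl, le_rfl⟩
  have key : ∀ ε > 0, u b - u a ≤
      (∫ τ in Ioo 0 l, supportFun K (γ τ) (deriv γ τ)) + ε * (l + 2) := by
    intro ε hε
    obtain ⟨δ₁, hδ₁, hd₁⟩ := h.exists_supportFun_le_add hbdd hε
    obtain ⟨δ₂, hδ₂, hd₂⟩ := (isCompact_Icc.image_of_continuousOn hγ.continuousOn
      ).exists_cthickening_subset_open hopen (mapsTo_iff_image_subset.1 hγ.mapsTo)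
    have hcont : ∀ c ∈ Ω, ∃ δ > 0, ∀ y, dist y c < δ → dist (u y) (u c) < ε := fun c hc =>
      Metric.continuousAt_iff.1 ((hsol.continuousOn.mono subset_closure).continuousAt
        (hopen.mem_nhds hc)) ε hε
    obtain ⟨δ₃, hδ₃, hd₃⟩ := hcont a ha
    obtain ⟨δ₄, hδ₄, hd₄⟩ := hcont b hb
    -- The mollification radius keeps the balls along the path in `Ω`, the support function within `ε`
    -- on them, and `u` within `ε` at the two end points.
    set δ := min (min δ₁ δ₂) (min δ₃ δ₄) with hδdef
    have hδ : 0 < δ := lt_min (lt_min hδ₁ hδ₂) (lt_min hδ₃ hδ₄)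
    have e1 : δ ≤ δ₁ := (min_le_left _ _).trans (min_le_left _ _)
    have e2 : δ ≤ δ₂ := (min_le_left _ _).trans (min_le_right _ _)
    have e3 : δ ≤ δ₃ := (min_le_right _ _).trans (min_le_left _ _)
    have e4 : δ ≤ δ₄ := (min_le_right _ _).trans (min_le_right _ _)
    let φ : ContDiffBump (0 : EuclideanSpace ℝ (Fin n)) :=
      ⟨δ / 4, δ / 2, by positivity, by linarith⟩
    have hφ : φ.rOut = δ / 2 := rfl
    have hballΩ : ∀ τ ∈ Icc 0 l, Metric.closedBall (γ τ) φ.rOut ⊆ Ω := fun τ hτ =>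
      (Metric.closedBall_subset_closedBall (by rw [hφ]; linarith)).trans
        ((Metric.closedBall_subset_cthickening (mem_image_of_mem γ hτ) δ₂).trans hd₂)
    set w := mollification Ω u (φ.normed volume) with hw
    have hwa : dist (w a) (u a) ≤ ε := dist_mollification_le hopen hbdd hsol.memLp φ
      (Metric.ball_subset_closedBall.trans (hγ.source ▸ hballΩ 0 ⟨le_rfl, hl⟩))
      fun y hy => (hd₃ y (lt_of_lt_of_le hy (by rw [hφ]; linarith))).le
    have hwb : dist (w b) (u b) ≤ ε := dist_mollification_le hopen hbdd hsol.memLp φ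
      (Metric.ball_subset_closedBall.trans (hγ.target ▸ hballΩ l ⟨hl, le_rfl⟩))
      fun y hy => (hd₄ y (lt_of_lt_of_le hy (by rw [hφ]; linarith))).le
    obtain ⟨C, hC⟩ := exists_lipschitzWith_mollification hopen hbdd hsol.memLp
      (ρ := φ.normed volume) φ.contDiff_normed φ.hasCompactSupport_normed
    obtain ⟨D, hD⟩ := hγ.lipschitz
    have hac : AbsolutelyContinuousOnInterval (w ∘ γ) 0 l :=
      LipschitzOnWith.absolutelyContinuousOnInterval (K := C * D)
        (by rw [uIcc_of_le hl]; exact hC.comp_lipschitzOnWith hD)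
    have hftc := hac.integral_deriv_eq_sub
    have hii := hac.intervalIntegrable_deriv
    rw [intervalIntegral.integral_of_le hl, ← restrict_Ioo_eq_restrict_Ioc] at hftc
    rw [intervalIntegrable_iff_integrableOn_Ioo_of_le hl] at hii
    have hle : ∫ τ in Ioo 0 l, deriv (w ∘ γ) τ ≤
        ∫ τ in Ioo 0 l, (supportFun K (γ τ) (deriv γ τ) + ε) := by
      refine integral_mono_ae hii
        ((h.integrableOn_supportFun_deriv hγ').add (integrable_const ε)) ?_
      filter_upwards [hγ.unitSpeed, ae_restrict_mem measurableSet_Ioo] with τ hτ hm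
      obtain ⟨L, hL, hLq⟩ := hsol.exists_hasFDerivAt_mollification_le h hopen hbdd φ
        (hballΩ τ (Ioo_subset_Icc_self hm))
      have hder : HasDerivAt (w ∘ γ) (L (deriv γ τ)) τ :=
        hL.comp_hasDerivAt τ hτ.1.hasDerivAt
      rw [hder.deriv]
      refine hLq _ _ fun y hy => ?_
      refine hd₁ (γ τ) (hγ'.mapsTo (Ioo_subset_Icc_self hm)) y
        (subset_closure (hballΩ τ (Ioo_subset_Icc_self hm) hy)) ?_ _ hτ.2
      exact lt_of_le_of_lt hy (by rw [hφ]; linarith)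
    rw [hftc, integral_add (h.integrableOn_supportFun_deriv hγ') (integrable_const ε)] at hle
    simp only [Function.comp_apply, hγ.source, hγ.target, integral_const, smul_eq_mul,
      measureReal_restrict_apply_univ, Real.volume_real_Ioo_of_le hl, sub_zero] at hle
    rw [Real.dist_eq] at hwa hwb
    linarith [(abs_le.1 hwa).2, (abs_le.1 hwb).1]
  refine le_of_forall_pos_le_add fun ε hε => ?_
  have hl2 : 0 < l + 2 := by linarith
  have := key (ε / (l + 2)) (by positivity)
  rwa [div_mul_cancel₀ _ hl2.ne'] at this

theorem IsSolution.ofReal_sub_le_interiorDist (h : IsFinslerField Ω K α M)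
    (hsol : IsSolution Ω K g u) (hopen : IsOpen Ω) (hbdd : Bornology.IsBounded Ω) :
    ENNReal.ofReal (u b - u a) ≤ interiorDist Ω K a b := by
  refine le_iInf fun l => le_iInf fun γ => le_iInf fun hγ => ?_
  rw [finslerLength_eq_finslerArc,
    ← h.ofReal_integral_supportFun (hγ.mono_set subset_closure) le_rfl le_rfl]
  exact ENNReal.ofReal_le_ofReal (hsol.sub_le_integral h hopen hbdd hγ)

/-- Solutions are 1-Lipschitz for the extended distance, by continuity up to the boundary. -/
theorem IsSolution.ofReal_sub_le_finslerDist (h : IsFinslerField Ω K α M)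
    (hsol : IsSolution Ω K g u) (hopen : IsOpen Ω) (hbdd : Bornology.IsBounded Ω)
    (ha : a ∈ closure Ω) (hb : b ∈ closure Ω) :
    ENNReal.ofReal (u b - u a) ≤ finslerDist Ω K a b := by
  refine le_iInf fun xs => le_iInf fun ys => le_iInf fun ⟨hxs, hys, hx, hy⟩ => ?_
  have lim : ∀ {c : EuclideanSpace ℝ (Fin n)} {cs : ℕ → EuclideanSpace ℝ (Fin n)}, c ∈ closure Ω →
      (∀ k, cs k ∈ Ω) → Tendsto cs atTop (𝓝 c) → Tendsto (fun k => u (cs k)) atTop (𝓝 (u c)) :=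
    fun hc hcs ht => (hsol.continuousOn _ hc).tendsto.comp
      (tendsto_nhdsWithin_iff.2 ⟨ht, Eventually.of_forall fun k => subset_closure (hcs k)⟩)
  have hlim := ((ENNReal.continuous_ofReal.tendsto _).comp ((lim hb hys hy).sub (lim ha hxs hx)))
  rw [← hlim.liminf_eq]
  exact liminf_le_liminf (Eventually.of_forall fun k =>
    hsol.ofReal_sub_le_interiorDist h hopen hbdd)

end Solutions

/-! ### Calibrated curves -/

section Calibration

variable {n : ℕ} {Ω : Set (EuclideanSpace ℝ (Fin n))}
  {K : EuclideanSpace ℝ (Fin n) → Set (EuclideanSpace ℝ (Fin n))} {α M : ℝ}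
  {l t : ℝ} {γ : ℝ → EuclideanSpace ℝ (Fin n)} {y₁ y₂ z : EuclideanSpace ℝ (Fin n)}
  {g u : EuclideanSpace ℝ (Fin n) → ℝ}

theorem EReal.coe_sub_coe_le_coe_add_coe {r s : ℝ} {p q : ENNReal}
    (h : ((r - s : ℝ) : EReal) ≤ ((p + q : ENNReal) : EReal)) :
    (r : EReal) - (q : EReal) ≤ (s : EReal) + (p : EReal) := by
  induction p using ENNReal.recTopCoe with
  | top => simp
  | coe p =>
    induction q using ENNReal.recTopCoe with
    | top => simp
    | coe q =>
      have h' : r - s ≤ (p : ℝ) + (q : ℝ) := by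
        rw [← ENNReal.coe_add, EReal.coe_nnreal_eq_coe_real, EReal.coe_le_coe_iff] at h
        exact_mod_cast h
      rw [EReal.coe_nnreal_eq_coe_real, EReal.coe_nnreal_eq_coe_real, ← EReal.coe_sub,
        ← EReal.coe_add, EReal.coe_le_coe_iff]
      linarith

/-- The extremal functions are ordered: this is the compatibility condition on `g` combined with the
triangle inequality. -/
theorem sMinus_le_sPlus (h : IsFinslerField Ω K α M) (hopen : IsOpen Ω)
    (hlip : HasLipschitzBoundary Ω)
    (hglip : ∀ y₁ ∈ frontier Ω, ∀ y₂ ∈ frontier Ω,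
      ((g y₂ - g y₁ : ℝ) : EReal) ≤ (finslerDist Ω K y₁ y₂ : EReal))
    (hz : z ∈ closure Ω) : sMinus Ω K g z ≤ sPlus Ω K g z := by
  refine iSup₂_le fun y hy => le_iInf₂ fun y' hy' => EReal.coe_sub_coe_le_coe_add_coe ?_
  refine (hglip y' hy' y hy).trans ?_
  exact_mod_cast h.finslerDist_triangle hopen hlip hz

/-- `γ` is a path in the closure joining two boundary points along which the boundary datum grows by
exactly the Finslerian length of `γ`. -/
structure IsCalibrated (Ω : Set (EuclideanSpace ℝ (Fin n)))
    (K : EuclideanSpace ℝ (Fin n) → Set (EuclideanSpace ℝ (Fin n)))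
    (g : EuclideanSpace ℝ (Fin n) → ℝ) (l : ℝ) (γ : ℝ → EuclideanSpace ℝ (Fin n))
    (y₁ y₂ : EuclideanSpace ℝ (Fin n)) : Prop where
  path : IsUnitSpeedPath (closure Ω) l γ y₁ y₂
  source_mem : y₁ ∈ frontier Ω
  target_mem : y₂ ∈ frontier Ω
  finslerLength_eq : finslerLength K l γ = ENNReal.ofReal (g y₂ - g y₁)
  sub_nonneg : 0 ≤ g y₂ - g y₁

namespace IsCalibrated

theorem finslerDist_eq (hc : IsCalibrated Ω K g l γ y₁ y₂) (h : IsFinslerField Ω K α M)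
    (hopen : IsOpen Ω) (hlip : HasLipschitzBoundary Ω)
    (hglip : ∀ y₁ ∈ frontier Ω, ∀ y₂ ∈ frontier Ω,
      ((g y₂ - g y₁ : ℝ) : EReal) ≤ (finslerDist Ω K y₁ y₂ : EReal)) :
    finslerDist Ω K y₁ y₂ = finslerLength K l γ := by
  refine le_antisymm ?_ ?_
  · have := h.finslerDist_le_finslerArc hopen hlip hc.path le_rfl hc.path.length_nonneg le_rfl
    rwa [hc.path.source, hc.path.target] at this
  · rw [hc.finslerLength_eq, ← EReal.coe_ennreal_le_coe_ennreal_iff, EReal.coe_ennreal_ofReal,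
      max_eq_left hc.sub_nonneg]
    exact hglip _ hc.source_mem _ hc.target_mem

theorem finslerArc_zero_eq (hc : IsCalibrated Ω K g l γ y₁ y₂) (h : IsFinslerField Ω K α M)
    (ht : t ∈ Icc 0 l) : finslerArc K γ 0 t =
      ENNReal.ofReal (∫ τ in (0)..t, supportFun K (γ τ) (deriv γ τ)) := by
  rw [← h.ofReal_integral_supportFun hc.path le_rfl ht.2, intervalIntegral.integral_of_le ht.1,
    restrict_Ioo_eq_restrict_Ioc]

theorem integral_nonneg (hc : IsCalibrated Ω K g l γ y₁ y₂) (h : IsFinslerField Ω K α M)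
    (ht : t ∈ Icc 0 l) : 0 ≤ ∫ τ in (0)..t, supportFun K (γ τ) (deriv γ τ) :=
  intervalIntegral.integral_nonneg ht.1 fun _ hτ =>
    h.supportFun_nonneg (hc.path.mapsTo ⟨hτ.1, hτ.2.trans ht.2⟩)

/-- The part of `γ` after the parameter `t` carries the growth of `g` that is still missing at `t`. -/
theorem finslerArc_end_le (hc : IsCalibrated Ω K g l γ y₁ y₂) (h : IsFinslerField Ω K α M)
    (ht : t ∈ Icc 0 l) : finslerArc K γ t l ≤ ENNReal.ofReal
      (g y₂ - (g y₁ + ∫ τ in (0)..t, supportFun K (γ τ) (deriv γ τ))) := by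
  have h1 := finslerArc_add_finslerArc (K := K) (γ := γ) ht.1 ht.2
  rw [← finslerLength_eq_finslerArc (l := l), hc.finslerLength_eq, hc.finslerArc_zero_eq h ht, add_comm] at h1
  rw [ENNReal.eq_sub_of_add_eq ENNReal.ofReal_ne_top h1,
    ← ENNReal.ofReal_sub _ (hc.integral_nonneg h ht), sub_sub]

theorem remaining_nonneg (hc : IsCalibrated Ω K g l γ y₁ y₂) (h : IsFinslerField Ω K α M)
    (ht : t ∈ Icc 0 l) :
    0 ≤ g y₂ - (g y₁ + ∫ τ in (0)..t, supportFun K (γ τ) (deriv γ τ)) := by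
  have h1 := finslerArc_add_finslerArc (K := K) (γ := γ) ht.1 ht.2
  rw [← finslerLength_eq_finslerArc (l := l), hc.finslerLength_eq, hc.finslerArc_zero_eq h ht] at h1
  have h2 := (ENNReal.ofReal_le_ofReal_iff hc.sub_nonneg).1 (le_self_add.trans_eq h1)
  linarith

/-- Along a calibrated curve the upper and the lower extremal function are squeezed between the
values prescribed by the two end points, which coincide. -/
theorem sMinus_eq_and_sPlus_eq (hc : IsCalibrated Ω K g l γ y₁ y₂) (h : IsFinslerField Ω K α M)
    (hopen : IsOpen Ω) (hlip : HasLipschitzBoundary Ω)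
    (hglip : ∀ y₁ ∈ frontier Ω, ∀ y₂ ∈ frontier Ω,
      ((g y₂ - g y₁ : ℝ) : EReal) ≤ (finslerDist Ω K y₁ y₂ : EReal)) (ht : t ∈ Icc 0 l) :
    sMinus Ω K g (γ t) =
        ((g y₁ + ∫ τ in (0)..t, supportFun K (γ τ) (deriv γ τ) : ℝ) : EReal) ∧
      sPlus Ω K g (γ t) =
        ((g y₁ + ∫ τ in (0)..t, supportFun K (γ τ) (deriv γ τ) : ℝ) : EReal) := by
  set A := ∫ τ in (0)..t, supportFun K (γ τ) (deriv γ τ) with hA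
  have hd₁ := h.finslerDist_le_finslerArc hopen hlip hc.path le_rfl ht.1 ht.2
  have hd₂ := h.finslerDist_le_finslerArc hopen hlip hc.path ht.1 ht.2 le_rfl
  rw [hc.path.source, hc.finslerArc_zero_eq h ht, ← EReal.coe_ennreal_le_coe_ennreal_iff,
    EReal.coe_ennreal_ofReal, max_eq_left (hc.integral_nonneg h ht)] at hd₁
  replace hd₂ := hd₂.trans (hc.finslerArc_end_le h ht)
  rw [hc.path.target, ← EReal.coe_ennreal_le_coe_ennreal_iff,
    EReal.coe_ennreal_ofReal, max_eq_left (hc.remaining_nonneg h ht)] at hd₂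
  have hplus : sPlus Ω K g (γ t) ≤ ((g y₁ + A : ℝ) : EReal) := by
    refine (iInf₂_le y₁ hc.source_mem).trans ?_
    rw [EReal.coe_add]
    gcongr
  have hminus : ((g y₁ + A : ℝ) : EReal) ≤ sMinus Ω K g (γ t) := by
    refine le_trans ?_ (le_iSup₂ (f := fun y (_ : y ∈ frontier Ω) =>
      (g y : EReal) - (finslerDist Ω K (γ t) y : EReal)) y₂ hc.target_mem)
    have := EReal.sub_le_sub (le_refl (g y₂ : EReal)) hd₂
    rwa [← EReal.coe_sub, sub_sub_cancel] at this
  have hle := sMinus_le_sPlus h hopen hlip hglip (hc.path.mapsTo ht)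
  exact ⟨le_antisymm (hle.trans hplus) hminus, le_antisymm hplus (hminus.trans hle)⟩

/-- A solution cannot grow faster than the length, and a calibrated curve leaves it no room to grow
more slowly. -/
theorem solution_eq (hc : IsCalibrated Ω K g l γ y₁ y₂) (h : IsFinslerField Ω K α M)
    (hopen : IsOpen Ω) (hlip : HasLipschitzBoundary Ω) (hbdd : Bornology.IsBounded Ω)
    (hsol : IsSolution Ω K g u) (ht : t ∈ Icc 0 l) :
    u (γ t) = g y₁ + ∫ τ in (0)..t, supportFun K (γ τ) (deriv γ τ) := by
  have hcl := hc.path.mapsTo ht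
  have hd₁ := h.finslerDist_le_finslerArc hopen hlip hc.path le_rfl ht.1 ht.2
  have hd₂ := h.finslerDist_le_finslerArc hopen hlip hc.path ht.1 ht.2 le_rfl
  rw [hc.path.source] at hd₁
  rw [hc.path.target] at hd₂
  have h₁ := (hsol.ofReal_sub_le_finslerDist h hopen hbdd
    (frontier_subset_closure hc.source_mem) hcl).trans
      (hd₁.trans_eq (hc.finslerArc_zero_eq h ht))
  have h₂ := (hsol.ofReal_sub_le_finslerDist h hopen hbdd hcl
    (frontier_subset_closure hc.target_mem)).trans (hd₂.trans (hc.finslerArc_end_le h ht))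
  rw [ENNReal.ofReal_le_ofReal_iff (hc.integral_nonneg h ht),
    hsol.boundary _ hc.source_mem] at h₁
  rw [ENNReal.ofReal_le_ofReal_iff (hc.remaining_nonneg h ht), hsol.boundary _ hc.target_mem] at h₂
  exact le_antisymm (by linarith) (by linarith)

end IsCalibrated

/-- A property of almost every parameter of a Lipschitz curve holds at all parameters over `H¹`-almost
every point, since Lipschitz maps send null sets of parameters to `H¹`-null sets. -/
theorem LipschitzOnWith.ae_hausdorffMeasure_image {C : NNReal} {P : ℝ → Prop}
    (hγ : LipschitzOnWith C γ (Icc 0 l)) (hP : ∀ᵐ s ∂(volume.restrict (Ioo 0 l)), P s)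
    (S : Set (EuclideanSpace ℝ (Fin n))) :
    ∀ᵐ z ∂((Measure.hausdorffMeasure 1 : Measure (EuclideanSpace ℝ (Fin n))).restrict S),
      ∀ s ∈ Ioo 0 l, γ s = z → P s := by
  refine ae_restrict_of_ae ?_
  rw [ae_restrict_iff' measurableSet_Ioo, ae_iff] at hP
  have hN : (Measure.hausdorffMeasure 1 : Measure (EuclideanSpace ℝ (Fin n)))
      (γ '' {s | ¬(s ∈ Ioo 0 l → P s)}) = 0 := by
    have hsub : {s | ¬(s ∈ Ioo 0 l → P s)} ⊆ Icc 0 l := fun s hs =>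
      Ioo_subset_Icc_self (Classical.not_imp.1 hs).1
    have := (hγ.mono hsub).hausdorffMeasure_image_le zero_le_one
    rw [hausdorffMeasure_real, hP, mul_zero] at this
    exact nonpos_iff_eq_zero.1 this
  refine measure_mono_null ?_ hN
  intro z hz
  simp only [mem_compl_iff, mem_ofPred_eq, not_forall] at hz
  obtain ⟨s, hs, hsz, hnP⟩ := hz
  exact ⟨s, fun hn => hnP (hn hs), hsz⟩

theorem IsFinslerField.ae_hasDerivAt_integral (h : IsFinslerField Ω K α M)
    (hγ : IsUnitSpeedPath (closure Ω) l γ y₁ y₂) :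
    ∀ᵐ s ∂(volume.restrict (Ioo 0 l)), HasDerivAt
      (fun t => ∫ τ in (0)..t, supportFun K (γ τ) (deriv γ τ))
      (supportFun K (γ s) (deriv γ s)) s := by
  have hl := hγ.length_nonneg
  have hi : IntervalIntegrable (fun τ => supportFun K (γ τ) (deriv γ τ)) volume 0 l := by
    rw [intervalIntegrable_iff_integrableOn_Ioo_of_le hl]
    exact h.integrableOn_supportFun_deriv hγ
  rw [ae_restrict_iff' measurableSet_Ioo]
  filter_upwards [hi.ae_hasDerivAt_integral] with s hs hm
  rw [uIcc_of_le hl] at hs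
  exact hs (Ioo_subset_Icc_self hm) 0 ⟨le_rfl, hl⟩

/-- Where the extremal functions coincide, an optimal path from the boundary followed by an optimal
path to the boundary is calibrated. -/
theorem isCalibrated_concatCurve {l₁ l₂ : ℝ} {γ₁ γ₂ : ℝ → EuclideanSpace ℝ (Fin n)}
    {x : EuclideanSpace ℝ (Fin n)} (h : IsFinslerField Ω K α M)
    (hS : sMinus Ω K g x = sPlus Ω K g x) (hy₁ : y₁ ∈ frontier Ω) (hy₂ : y₂ ∈ frontier Ω)
    (hγ₁ : IsUnitSpeedPath (closure Ω) l₁ γ₁ y₁ x) (hγ₂ : IsUnitSpeedPath (closure Ω) l₂ γ₂ x y₂)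
    (hopt₁ : sPlus Ω K g x = (g y₁ : EReal) + (finslerLength K l₁ γ₁ : EReal))
    (hopt₂ : sMinus Ω K g x = (g y₂ : EReal) - (finslerLength K l₂ γ₂ : EReal)) :
    IsCalibrated Ω K g (l₁ + l₂) (concatCurve l₁ γ₁ γ₂) y₁ y₂ := by
  have hf : finslerLength K (l₁ + l₂) (concatCurve l₁ γ₁ γ₂) = _ :=
    finslerLength_concatCurve hγ₁.length_nonneg hγ₂.length_nonneg
  have hL₁ : finslerLength K l₁ γ₁ ≠ ⊤ := ne_top_of_le_ne_top ENNReal.ofReal_ne_top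
    (h.finslerLength_le hγ₁)
  have hL₂ : finslerLength K l₂ γ₂ ≠ ⊤ := ne_top_of_le_ne_top ENNReal.ofReal_ne_top
    (h.finslerLength_le hγ₂)
  rw [hopt₁, hopt₂] at hS
  lift finslerLength K l₁ γ₁ to NNReal using hL₁ with L₁
  lift finslerLength K l₂ γ₂ to NNReal using hL₂ with L₂
  have hS' : g y₂ - (L₂ : ℝ) = g y₁ + (L₁ : ℝ) := by
    rw [EReal.coe_nnreal_eq_coe_real, EReal.coe_nnreal_eq_coe_real, ← EReal.coe_sub,
      ← EReal.coe_add, EReal.coe_eq_coe_iff] at hS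
    exact hS
  have he : g y₂ - g y₁ = ((L₁ + L₂ : NNReal) : ℝ) := by push_cast; linarith
  refine ⟨hγ₁.concat hγ₂, hy₁, hy₂, ?_, ?_⟩
  · rw [hf, he, ENNReal.ofReal_coe_nnreal, ENNReal.coe_add]
  · rw [he]
    exact NNReal.coe_nonneg _

end Calibration

/-! ### The theorem on coincidence points -/

theorem mainTheorem1 {n : ℕ} (Ω : Set (EuclideanSpace ℝ (Fin n)))
    (hopen : IsOpen Ω) (hconn : IsConnected Ω) (hbdd : Bornology.IsBounded Ω)
    (hlip : HasLipschitzBoundary Ω)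
    (K : EuclideanSpace ℝ (Fin n) → Set (EuclideanSpace ℝ (Fin n)))
    (hKcompact : ∀ x ∈ closure Ω, IsCompact (K x))
    (hKconvex : ∀ x ∈ closure Ω, Convex ℝ (K x))
    (hKball : ∃ α M : ℝ, 0 < α ∧ 0 < M ∧
      ∀ x ∈ closure Ω, Metric.ball 0 α ⊆ K x ∧ K x ⊆ Metric.ball 0 M)
    (hKcont : ∀ p : EuclideanSpace ℝ (Fin n),
      ContinuousOn (fun x => gauge (K x) p) (closure Ω))
    (g : EuclideanSpace ℝ (Fin n) → ℝ) (hgcont : ContinuousOn g (frontier Ω))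
    (hglip : ∀ y₁ ∈ frontier Ω, ∀ y₂ ∈ frontier Ω,
      ((g y₂ - g y₁ : ℝ) : EReal) ≤ (finslerDist Ω K y₁ y₂ : EReal))
    (x : EuclideanSpace ℝ (Fin n)) (hx : x ∈ Ω) (hS : sMinus Ω K g x = sPlus Ω K g x)
    (y₁ y₂ : EuclideanSpace ℝ (Fin n)) (hy₁ : y₁ ∈ frontier Ω) (hy₂ : y₂ ∈ frontier Ω)
    (l₁ l₂ : ℝ) (γ₁ γ₂ : ℝ → EuclideanSpace ℝ (Fin n))
    (hγ₁ : IsUnitSpeedPath (closure Ω) l₁ γ₁ y₁ x)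
    (hγ₂ : IsUnitSpeedPath (closure Ω) l₂ γ₂ x y₂)
    (hopt₁ : sPlus Ω K g x = (g y₁ : EReal) + (finslerLength K l₁ γ₁ : EReal))
    (hopt₂ : sMinus Ω K g x = (g y₂ : EReal) - (finslerLength K l₂ γ₂ : EReal)) :
    -- the concatenated curve is an admissible curve and a geodesic from `y₁` to `y₂`
    IsUnitSpeedPath (closure Ω) (l₁ + l₂) (concatCurve l₁ γ₁ γ₂) y₁ y₂ ∧
    finslerDist Ω K y₁ y₂ ≠ ⊤ ∧
    finslerDist Ω K y₁ y₂ = finslerLength K (l₁ + l₂) (concatCurve l₁ γ₁ γ₂) ∧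
    -- along the curve `S⁻` and `S⁺` are finite and coincide with each other and every solution
    (∀ t ∈ Icc 0 (l₁ + l₂),
      sPlus Ω K g (concatCurve l₁ γ₁ γ₂ t) ≠ ⊥ ∧
      sPlus Ω K g (concatCurve l₁ γ₁ γ₂ t) ≠ ⊤ ∧
      sMinus Ω K g (concatCurve l₁ γ₁ γ₂ t) = sPlus Ω K g (concatCurve l₁ γ₁ γ₂ t) ∧
      ∀ u : EuclideanSpace ℝ (Fin n) → ℝ, IsSolution Ω K g u →
        (u (concatCurve l₁ γ₁ γ₂ t) : EReal) = sPlus Ω K g (concatCurve l₁ γ₁ γ₂ t)) ∧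
    -- at `H¹`-almost every point of the curve the derivatives along the curve exist
    (∀ᵐ z ∂((Measure.hausdorffMeasure 1 : Measure (EuclideanSpace ℝ (Fin n))).restrict
        (concatCurve l₁ γ₁ γ₂ '' Icc 0 (l₁ + l₂))),
      ∀ s ∈ Ioo 0 (l₁ + l₂), concatCurve l₁ γ₁ γ₂ s = z →
        DifferentiableAt ℝ (concatCurve l₁ γ₁ γ₂) s ∧
        HasDerivAt (fun t => (sPlus Ω K g (concatCurve l₁ γ₁ γ₂ t)).toReal)
          (supportFun K (concatCurve l₁ γ₁ γ₂ s) (deriv (concatCurve l₁ γ₁ γ₂) s)) s ∧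
        HasDerivAt (fun t => (sMinus Ω K g (concatCurve l₁ γ₁ γ₂ t)).toReal)
          (supportFun K (concatCurve l₁ γ₁ γ₂ s) (deriv (concatCurve l₁ γ₁ γ₂) s)) s ∧
        ∀ u : EuclideanSpace ℝ (Fin n) → ℝ, IsSolution Ω K g u →
          HasDerivAt (fun t => u (concatCurve l₁ γ₁ γ₂ t))
            (supportFun K (concatCurve l₁ γ₁ γ₂ s) (deriv (concatCurve l₁ γ₁ γ₂) s)) s) := by
  obtain ⟨α, M, hα, hM, hball⟩ := hKball
  have h : IsFinslerField Ω K α M := ⟨hα, hM, hKcompact, hKconvex, fun x hx => (hball x hx).1,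
    fun x hx => (hball x hx).2, hKcont⟩
  have hc := isCalibrated_concatCurve h hS hy₁ hy₂ hγ₁ hγ₂ hopt₁ hopt₂
  set γ := concatCurve l₁ γ₁ γ₂
  set l := l₁ + l₂
  have hd := hc.finslerDist_eq h hopen hlip hglip
  have hval := fun t (ht : t ∈ Icc 0 l) => hc.sMinus_eq_and_sPlus_eq h hopen hlip hglip ht
  refine ⟨hc.path, ?_, hd, fun t ht => ?_, ?_⟩
  · rw [hd, hc.finslerLength_eq]
    exact ENNReal.ofReal_ne_top
  · obtain ⟨hm, hp⟩ := hval t ht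
    refine ⟨?_, ?_, hm.trans hp.symm, fun u hu => ?_⟩
    · rw [hp]
      exact EReal.coe_ne_bot _
    · rw [hp]
      exact EReal.coe_ne_top _
    · rw [hp, hc.solution_eq h hopen hlip hbdd hu ht]
  · obtain ⟨C, hC⟩ := hc.path.lipschitz
    have hae := hC.ae_hausdorffMeasure_image
      (hc.path.unitSpeed.and (h.ae_hasDerivAt_integral hc.path)) (γ '' Icc 0 l)
    filter_upwards [hae] with z hz s hs hsz
    obtain ⟨⟨hdiff, -⟩, hder⟩ := hz s hs hsz
    have hF := hder.const_add (g y₁)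
    have hnear : ∀ᶠ t in 𝓝 s, t ∈ Icc 0 l := by
      filter_upwards [isOpen_Ioo.mem_nhds hs] with t ht using Ioo_subset_Icc_self ht
    refine ⟨hdiff, hF.congr_of_eventuallyEq ?_, hF.congr_of_eventuallyEq ?_,
      fun u hu => hF.congr_of_eventuallyEq ?_⟩
    · filter_upwards [hnear] with t ht
      rw [(hval t ht).2, EReal.toReal_coe]
    · filter_upwards [hnear] with t ht
      rw [(hval t ht).1, EReal.toReal_coe]
    · filter_upwards [hnear] with t ht using hc.solution_eq h hopen hlip hbdd hu ht
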